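/- Let $0<q<1$. Let $\mathcal{A}(SU_q(2))$ be the complex $*$-algebra generated by $a,c$ with relations $ac=q\,ca$, $c^*a^*=q\,a^*c^*$, $ac^*=q\,c^*a$, $ca^*=q\,a^*c$, $cc^*=c^*c$, $a^*a+c^*c=1=aa^*+q^2cc^*$, let $h$ be its normalized (positive, invariant) Haar state, and let $U(1)$ act on it by the algebra automorphisms $\alpha_z$ with $\alpha_z(a)=az$, $\alpha_z(c)=cz$, $\alpha_z(a^*)=a^*z^*$, $\alpha_z(c^*)=c^*z^*$. Put $\mathcal{L}_m=\{x:\alpha_z(x)=x(z^*)^m\ \forall z\in U(1)\}$; the coordinate algebra of the quantum projective line is $\mathcal{A}(\mathbb{CP}^1_q)=\mathcal{L}_0$. Let $K^{\pm1},E,F$ act by the left action of $\mathcal{U}_q(su(2))$, that is $K$ is the algebra automorphism with $K\triangleright a=q^{-1/2}a$, $K\triangleright c=q^{-1/2}c$, $K\triangleright a^*=q^{1/2}a^*$, $K\triangleright c^*=q^{1/2}c^*$, and $E,F$ are the linear maps with $E\triangleright a=-q c^*$, $E\triangleright c=a^*$, $E\triangleright a^*=E\triangleright c^*=0$, $F\triangleright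 a^*=c$, $F\triangleright c^*=-q^{-1}a$, $F\triangleright a=F\triangleright c=0$ and $Y\triangleright(xy)=(Y\triangleright x)(K\triangleright y)+(K^{-1}\triangleright x)(Y\triangleright y)$ for $Y=E,F$. Set $X_+=q^{1/2}EK$ and $X_-=q^{-1/2}FK$. The two-dimensional calculus on $\mathbb{CP}^1_q$ is $\Omega^1=\mathcal{L}_{-2}\,\omega_-\oplus\mathcal{L}_{2}\,\omega_+$, $\Omega^2=\mathcal{A}(\mathbb{CP}^1_q)\,\omega_-\wedge\omega_+$, with $\partial f=(X_+\triangleright f)\,\omega_+$, $\bar\partial f=(X_-\triangleright f)\,\omega_-$, $\mathrm{d}=\partial+\bar\partial$, the product $(x\,\omega_-+y\,\omega_+)\wedge(t\,\omega_-+z\,\omega_+)=(q^2xz-yt)\,\omega_-\wedge\omega_+$, the Hodge operator $\star(x\,\omega_-+y\,\omega_+)=-x\,\omega_-+y\,\omega_+$, and the integral $\int_h f\,\omega_-\wedge\omega_+=h(f)$. These operations are extended to matrices of functions and forms in the usual way. For $n\ge 0$ and $M\in \mathrm{Mat}_{n+1}$, with rows and columns numbered $0,\dots,n$, the quantum trace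 is $\mathrm{qtr}(M)=\sum_{j,l}M_{jl}\,(\pi_{n/2}(K^2))_{lj}=\sum_{j=0}^{n}q^{\,n-2j}M_{jj}$, applied to the coefficient of $\omega_-\wedge\omega_+$ for matrices of two-forms. **Proposition.** Let $n\ge 0$ and let $P\in\mathrm{Mat}_{n+1}(\mathcal{A}(\mathbb{CP}^1_q))$ be a projection, $P^2=P=P^*$. 1. The number $\int_h\mathrm{qtr}(P(\star \mathrm{d}P)\wedge \mathrm{d}P)$ is real, and $$\int_h\mathrm{qtr}\big(P(\star \mathrm{d}P)\wedge \mathrm{d}P\big)\ \ge\ \Big|\int_h\mathrm{qtr}\big(P\,\mathrm{d}P\wedge \mathrm{d}P\big)\Big| .$$ 2. Equality holds if and only if $P$ satisfies one of the two self-duality equations $\star P\,\mathrm{d}P=+P\,\mathrm{d}P$ or $\star P\,\mathrm{d}P=-P\,\mathrm{d}P$. 3. $\star P\,\mathrm{d}P=-P\,\mathrm{d}P$ if and only if $P\,\partial P=0$, and $\star P\,\mathrm{d}P=+P\,\mathrm{d}P$ if and only if $P\,\bar\partial P=0$. A projection with $\star P\,\mathrm{d}P=P\,\mathrm{d}P$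 is called a twisted sigma-model instanton, one with $\star P\,\mathrm{d}P=-P\,\mathrm{d}P$ an anti-instanton; thus $P\,\bar\partial P=0$ gives instantons and $P\,\partial P=0$ gives anti-instantons. -/

import Mathlib

namespace QuantumProjectiveLine

/-- The deformation parameter: a real number `q` with `0 < q < 1`. -/
abbrev DefParam : Type := Set.Ioo (0 : ℝ) 1

/-- The deformation parameter as a complex number. -/
noncomputable def qC (q : DefParam) : ℂ := ((q : ℝ) : ℂ)

/-- The square root `q ^ (1/2)` as a complex number. -/
noncomputable def qHalf (q : DefParam) : ℂ := ((Real.sqrt (q : ℝ) : ℝ) : ℂ)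

theorem qC_ne_zero (q : DefParam) : qC q ≠ 0 :=
  Complex.ofReal_ne_zero.2 q.2.1.ne'

theorem qHalf_mul_self (q : DefParam) : qHalf q * qHalf q = qC q := by
  rw [qHalf, qC, ← Complex.ofReal_mul, Real.mul_self_sqrt q.2.1.le]

theorem qHalf_ne_zero (q : DefParam) : qHalf q ≠ 0 :=
  Complex.ofReal_ne_zero.2 (Real.sqrt_pos.2 q.2.1).ne'

/-- Names of the generators `a, a*, c, c*`. -/
inductive Gen : Type
  | a | aStar | c | cStar

section
open Gen FreeAlgebra

/-- The defining relations of the coordinate algebra of quantum `SU(2)`. -/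
inductive Rel (q : DefParam) : FreeAlgebra ℂ Gen → FreeAlgebra ℂ Gen → Prop
  | a_c : Rel q (ι ℂ a * ι ℂ c) (qC q • (ι ℂ c * ι ℂ a))
  | cStar_aStar : Rel q (ι ℂ cStar * ι ℂ aStar) (qC q • (ι ℂ aStar * ι ℂ cStar))
  | a_cStar : Rel q (ι ℂ a * ι ℂ cStar) (qC q • (ι ℂ cStar * ι ℂ a))
  | c_aStar : Rel q (ι ℂ c * ι ℂ aStar) (qC q • (ι ℂ aStar * ι ℂ c))
  | c_cStar : Rel q (ι ℂ c * ι ℂ cStar) (ι ℂ cStar * ι ℂ c)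
  | aStar_a : Rel q (ι ℂ aStar * ι ℂ a + ι ℂ cStar * ι ℂ c) 1
  | a_aStar : Rel q (ι ℂ a * ι ℂ aStar + (qC q ^ 2) • (ι ℂ c * ι ℂ cStar)) 1

end

/-- The same relations for four elements of an arbitrary complex algebra. -/
structure Relations (q : DefParam) {B : Type} [Ring B] [Algebra ℂ B] (a aS c cS : B) : Prop where
  a_c : a * c = qC q • (c * a)
  cS_aS : cS * aS = qC q • (aS * cS)
  a_cS : a * cS = qC q • (cS * a)
  c_aS : c * aS = qC q • (aS * c)
  c_cS : c * cS = cS * c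
  aS_a : aS * a + cS * c = 1
  a_aS : a * aS + (qC q ^ 2) • (c * cS) = 1

/-- The coordinate algebra `A(SU_q(2))`: the complex algebra generated by `a, a*, c, c*` subject to
the relations above. -/
def SUq (q : DefParam) : Type := RingQuot (Rel q)

namespace SUq

noncomputable instance (q : DefParam) : Ring (SUq q) :=
  inferInstanceAs (Ring (RingQuot (Rel q)))

noncomputable instance (q : DefParam) : Algebra ℂ (SUq q) :=
  inferInstanceAs (Algebra ℂ (RingQuot (Rel q)))

/-- The quotient map from the free algebra. -/
noncomputable def mk (q : DefParam) : FreeAlgebra ℂ Gen →ₐ[ℂ] SUq q :=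
  RingQuot.mkAlgHom ℂ (Rel q)

theorem mk_rel {q : DefParam} {x y : FreeAlgebra ℂ Gen} (h : Rel q x y) : mk q x = mk q y :=
  RingQuot.mkAlgHom_rel ℂ h

/-- The generators of `A(SU_q(2))`. -/
noncomputable def gen (q : DefParam) (g : Gen) : SUq q := mk q (FreeAlgebra.ι ℂ g)

theorem relations (q : DefParam) :
    Relations q (gen q .a) (gen q .aStar) (gen q .c) (gen q .cStar) := by
  constructor
  · simpa only [gen, map_mul, map_smul] using mk_rel (q := q) Rel.a_c
  · simpa only [gen, map_mul, map_smul] using mk_rel (q := q) Rel.cStar_aStar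
  · simpa only [gen, map_mul, map_smul] using mk_rel (q := q) Rel.a_cStar
  · simpa only [gen, map_mul, map_smul] using mk_rel (q := q) Rel.c_aStar
  · simpa only [gen, map_mul, map_smul] using mk_rel (q := q) Rel.c_cStar
  · simpa only [gen, map_mul, map_smul, map_add, map_one] using mk_rel (q := q) Rel.aStar_a
  · simpa only [gen, map_mul, map_smul, map_add, map_one] using mk_rel (q := q) Rel.a_aStar

/-- The universal property: four elements satisfying the relations define an algebra map. -/
noncomputable def lift {q : DefParam} {B : Type} [Ring B] [Algebra ℂ B] {a aS c cS : B}
    (h : Relations q a aS c cS) : SUq q →ₐ[ℂ] B :=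
  RingQuot.liftAlgHom ℂ ⟨FreeAlgebra.lift ℂ (fun g => match g with
    | .a => a | .aStar => aS | .c => c | .cStar => cS), by
      intro x y r
      cases r <;> simp only [map_mul, map_smul, map_add, map_one, FreeAlgebra.lift_ι_apply]
      exacts [h.a_c, h.cS_aS, h.a_cS, h.c_aS, h.c_cS, h.aS_a, h.a_aS]⟩

section
variable {q : DefParam} {B : Type} [Ring B] [Algebra ℂ B] {a aS c cS : B}

@[simp] theorem lift_a (h : Relations q a aS c cS) : lift h (gen q .a) = a :=
  (RingQuot.liftAlgHom_mkAlgHom_apply ℂ _ _ _).trans (by simp)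

@[simp] theorem lift_aStar (h : Relations q a aS c cS) : lift h (gen q .aStar) = aS :=
  (RingQuot.liftAlgHom_mkAlgHom_apply ℂ _ _ _).trans (by simp)

@[simp] theorem lift_c (h : Relations q a aS c cS) : lift h (gen q .c) = c :=
  (RingQuot.liftAlgHom_mkAlgHom_apply ℂ _ _ _).trans (by simp)

@[simp] theorem lift_cStar (h : Relations q a aS c cS) : lift h (gen q .cStar) = cS :=
  (RingQuot.liftAlgHom_mkAlgHom_apply ℂ _ _ _).trans (by simp)

end

theorem induction {q : DefParam} {p : SUq q → Prop} (hs : ∀ z : ℂ, p (algebraMap ℂ _ z))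
    (hg : ∀ g, p (gen q g)) (hm : ∀ x y, p x → p y → p (x * y))
    (ha : ∀ x y, p x → p y → p (x + y)) (x : SUq q) : p x := by
  obtain ⟨y, rfl⟩ := RingQuot.mkAlgHom_surjective ℂ (Rel q) x
  induction y using FreeAlgebra.induction with
  | grade0 r => rw [AlgHom.commutes]; exact hs r
  | grade1 g => exact hg g
  | mul x y hx hy => rw [map_mul]; exact hm _ _ hx hy
  | add x y hx hy => rw [map_add]; exact ha _ _ hx hy

/-! ### The `*`-structure -/

/-- The opposite of an algebra, with complex scalars acting through complex conjugation. -/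
def ConjOp (B : Type) : Type := Bᵐᵒᵖ

noncomputable instance (B : Type) [Ring B] : Ring (ConjOp B) := inferInstanceAs (Ring Bᵐᵒᵖ)

noncomputable instance (B : Type) [Ring B] [Algebra ℂ B] : Algebra ℂ (ConjOp B) :=
  RingHom.toAlgebra' ((algebraMap ℂ Bᵐᵒᵖ).comp (starRingEnd ℂ)) fun z x =>
    Algebra.commutes (A := Bᵐᵒᵖ) (starRingEnd ℂ z) x

/-- An element of an algebra, as an element of the conjugate opposite algebra. -/
def toConjOp {B : Type} (x : B) : ConjOp B := MulOpposite.op x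

/-- The underlying element of an element of the conjugate opposite algebra. -/
def ofConjOp {B : Type} (x : ConjOp B) : B := MulOpposite.unop x

theorem smul_toConjOp {B : Type} [Ring B] [Algebra ℂ B] (z : ℂ) (x : B) :
    z • toConjOp x = toConjOp (starRingEnd ℂ z • x) := by
  refine (Algebra.smul_def z (toConjOp x)).trans ?_
  exact (Algebra.smul_def (A := Bᵐᵒᵖ) (starRingEnd ℂ z) (MulOpposite.op x)).symm

theorem relations_toConjOp {q : DefParam} {B : Type} [Ring B] [Algebra ℂ B] {a aS c cS : B}
    (h : Relations q a aS c cS) :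
    Relations q (toConjOp aS) (toConjOp a) (toConjOp cS) (toConjOp c) := by
  have m (x y : B) : toConjOp x * toConjOp y = toConjOp (y * x) := rfl
  have p (x y : B) : toConjOp x + toConjOp y = toConjOp (x + y) := rfl
  have k : starRingEnd ℂ (qC q) = qC q := Complex.conj_ofReal _
  constructor <;> simp only [m, p, smul_toConjOp, map_pow, k]
  · rw [h.cS_aS]
  · rw [h.a_c]
  · rw [h.c_aS]
  · rw [h.a_cS]
  · rw [h.c_cS]
  · rw [h.aS_a]; rfl
  · rw [h.a_aS]; rfl

/-- The `*`-operation as an algebra map to the conjugate opposite algebra: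
`a ↦ a*`, `a* ↦ a`, `c ↦ c*`, `c* ↦ c`. -/
noncomputable def starHom (q : DefParam) : SUq q →ₐ[ℂ] ConjOp (SUq q) :=
  lift (relations_toConjOp (relations q))

noncomputable instance (q : DefParam) : Star (SUq q) := ⟨fun x => ofConjOp (starHom q x)⟩

theorem star_mul' {q : DefParam} (x y : SUq q) : star (x * y) = star y * star x :=
  congrArg ofConjOp (map_mul (starHom q) x y)

theorem star_add' {q : DefParam} (x y : SUq q) : star (x + y) = star x + star y :=
  congrArg ofConjOp (map_add (starHom q) x y)

theorem star_smul' {q : DefParam} (z : ℂ) (x : SUq q) :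
    star (z • x) = starRingEnd ℂ z • star x := by
  refine (congrArg ofConjOp (map_smul (starHom q) z x)).trans ?_
  exact congrArg ofConjOp (smul_toConjOp z (star x))

theorem star_one' (q : DefParam) : star (1 : SUq q) = 1 :=
  congrArg ofConjOp (map_one (starHom q))

@[simp] theorem star_a (q : DefParam) : star (gen q .a) = gen q .aStar :=
  congrArg ofConjOp (lift_a (relations_toConjOp (relations q)))

@[simp] theorem star_aStar (q : DefParam) : star (gen q .aStar) = gen q .a :=
  congrArg ofConjOp (lift_aStar (relations_toConjOp (relations q)))

@[simp] theorem star_c (q : DefParam) : star (gen q .c) = gen q .cStar :=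
  congrArg ofConjOp (lift_c (relations_toConjOp (relations q)))

@[simp] theorem star_cStar (q : DefParam) : star (gen q .cStar) = gen q .c :=
  congrArg ofConjOp (lift_cStar (relations_toConjOp (relations q)))

noncomputable instance (q : DefParam) : StarRing (SUq q) where
  star_involutive x := by
    induction x using induction with
    | hs z =>
      rw [Algebra.algebraMap_eq_smul_one, star_smul', star_smul', star_one', star_one',
        Complex.conj_conj]
    | hg g => cases g <;> simp
    | hm x y hx hy => rw [star_mul', star_mul', hx, hy]
    | ha x y hx hy => rw [star_add', star_add', hx, hy]
  star_mul := star_mul'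
  star_add := star_add'

instance (q : DefParam) : StarModule ℂ (SUq q) := ⟨star_smul'⟩

/-! ### The torus action and the actions of `K`, `E`, `F` -/

theorem relations_scale (q : DefParam) (t : ℂˣ) :
    Relations q ((t : ℂ) • gen q .a) ((t⁻¹ : ℂ) • gen q .aStar)
      ((t : ℂ) • gen q .c) ((t⁻¹ : ℂ) • gen q .cStar) := by
  have h := relations q
  constructor <;>
    simp only [smul_mul_smul_comm, h.a_c, h.cS_aS, h.a_cS, h.c_aS, h.c_cS, smul_comm _ (qC q),
      mul_inv_cancel₀ t.ne_zero, inv_mul_cancel₀ t.ne_zero, one_smul]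
  · exact h.aS_a
  · rw [← h.c_cS]; exact h.a_aS

/-- Rescaling `a ↦ t a`, `c ↦ t c`, `a* ↦ t⁻¹ a*`, `c* ↦ t⁻¹ c*` by a nonzero complex number. -/
noncomputable def scale (q : DefParam) (t : ℂˣ) : SUq q →ₐ[ℂ] SUq q :=
  lift (relations_scale q t)

/-- The action `α` of `U(1)`: `α_z(a) = a z`, `α_z(a*) = a* z*`, `α_z(c) = c z`,
`α_z(c*) = c* z*`. -/
noncomputable def α (q : DefParam) (z : Circle) : SUq q →ₐ[ℂ] SUq q :=
  scale q (Circle.toUnits z)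

/-- The left action of `K`: `K ▷ a = q^(-1/2) a`, `K ▷ c = q^(-1/2) c`, `K ▷ a* = q^(1/2) a*`,
`K ▷ c* = q^(1/2) c*`, extended as an algebra map because `K` is group-like. -/
noncomputable def K (q : DefParam) : SUq q →ₐ[ℂ] SUq q :=
  scale q (Units.mk0 (qHalf q) (qHalf_ne_zero q))⁻¹

/-- The left action of `K⁻¹`. -/
noncomputable def Kinv (q : DefParam) : SUq q →ₐ[ℂ] SUq q :=
  scale q (Units.mk0 (qHalf q) (qHalf_ne_zero q))

theorem relations_E (q : DefParam) :
    Relations q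
      !![Kinv q (gen q .a), -(qC q • gen q .cStar); 0, K q (gen q .a)]
      !![Kinv q (gen q .aStar), 0; 0, K q (gen q .aStar)]
      !![Kinv q (gen q .c), gen q .aStar; 0, K q (gen q .c)]
      !![Kinv q (gen q .cStar), 0; 0, K q (gen q .cStar)] := by
  have h := relations q
  have r := qHalf_mul_self q
  have r0 := qHalf_ne_zero q
  have h1 : gen q .aStar * gen q .a = 1 - gen q .cStar * gen q .c := by
    rw [← h.aS_a]; abel
  have h2 : gen q .a * gen q .aStar = 1 - (qC q ^ 2) • (gen q .cStar * gen q .c) := by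
    rw [← h.a_aS, h.c_cS]; abel
  constructor <;> ext i j <;> fin_cases i <;> fin_cases j <;>
    simp [K, Kinv, scale, h.a_c, h.cS_aS, h.a_cS, h.c_aS, h.c_cS, h1, h2, smul_smul]
  all_goals
    try simp only [← r]
    match_scalars <;> field_simp <;> ring

theorem relations_F (q : DefParam) :
    Relations q
      !![Kinv q (gen q .a), 0; 0, K q (gen q .a)]
      !![Kinv q (gen q .aStar), gen q .c; 0, K q (gen q .aStar)]
      !![Kinv q (gen q .c), 0; 0, K q (gen q .c)]
      !![Kinv q (gen q .cStar), -((qC q)⁻¹ • gen q .a); 0, K q (gen q .cStar)] := by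
  have h := relations q
  have r := qHalf_mul_self q
  have r0 := qHalf_ne_zero q
  have h1 : gen q .aStar * gen q .a = 1 - gen q .cStar * gen q .c := by
    rw [← h.aS_a]; abel
  have h2 : gen q .a * gen q .aStar = 1 - (qC q ^ 2) • (gen q .cStar * gen q .c) := by
    rw [← h.a_aS, h.c_cS]; abel
  constructor <;> ext i j <;> fin_cases i <;> fin_cases j <;>
    simp [K, Kinv, scale, h.a_c, h.cS_aS, h.a_cS, h.c_aS, h.c_cS, h1, h2, smul_smul]
  all_goals
    try simp only [← r]
    match_scalars <;> field_simp <;> ring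

/-- The left action of `E`: `E ▷ a = -q c*`, `E ▷ c = a*`, `E ▷ a* = E ▷ c* = 0`, extended by
the coproduct `Δ(E) = E ⊗ K + K⁻¹ ⊗ E`; this twisted Leibniz rule says exactly that
`x ↦ !![K⁻¹ ▷ x, E ▷ x; 0, K ▷ x]` is an algebra map. -/
noncomputable def E (q : DefParam) : SUq q →ₗ[ℂ] SUq q :=
  Matrix.entryLinearMap ℂ (SUq q) 0 1 ∘ₗ (lift (relations_E q)).toLinearMap

/-- The left action of `F`: `F ▷ a* = c`, `F ▷ c* = -q⁻¹ a`, `F ▷ a = F ▷ c = 0`, extended by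
the coproduct `Δ(F) = F ⊗ K + K⁻¹ ⊗ F`. -/
noncomputable def F (q : DefParam) : SUq q →ₗ[ℂ] SUq q :=
  Matrix.entryLinearMap ℂ (SUq q) 0 1 ∘ₗ (lift (relations_F q)).toLinearMap

theorem lift_E (q : DefParam) (x : SUq q) :
    lift (relations_E q) x = !![Kinv q x, E q x; 0, K q x] := by
  have h : lift (relations_E q) x 0 0 = Kinv q x ∧ lift (relations_E q) x 1 0 = 0 ∧
      lift (relations_E q) x 1 1 = K q x := by
    induction x using induction with
    | hs z => simp [Matrix.algebraMap_matrix_apply]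
    | hg g => cases g <;> simp
    | hm x y hx hy => simp [Matrix.mul_apply, hx, hy]
    | ha x y hx hy => simp [hx, hy]
  ext i j
  fin_cases i <;> fin_cases j <;> simp [h, E]

theorem lift_F (q : DefParam) (x : SUq q) :
    lift (relations_F q) x = !![Kinv q x, F q x; 0, K q x] := by
  have h : lift (relations_F q) x 0 0 = Kinv q x ∧ lift (relations_F q) x 1 0 = 0 ∧
      lift (relations_F q) x 1 1 = K q x := by
    induction x using induction with
    | hs z => simp [Matrix.algebraMap_matrix_apply]
    | hg g => cases g <;> simp
    | hm x y hx hy => simp [Matrix.mul_apply, hx, hy]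
    | ha x y hx hy => simp [hx, hy]
  ext i j
  fin_cases i <;> fin_cases j <;> simp [h, F]

theorem E_mul (q : DefParam) (x y : SUq q) :
    E q (x * y) = Kinv q x * E q y + E q x * K q y := by
  have h := congrArg (fun M : Matrix (Fin 2) (Fin 2) (SUq q) => M 0 1)
    (map_mul (lift (relations_E q)) x y)
  simpa [lift_E] using h

theorem F_mul (q : DefParam) (x y : SUq q) :
    F q (x * y) = Kinv q x * F q y + F q x * K q y := by
  have h := congrArg (fun M : Matrix (Fin 2) (Fin 2) (SUq q) => M 0 1)
    (map_mul (lift (relations_F q)) x y)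
  simpa [lift_F] using h

theorem E_gen (q : DefParam) : E q (gen q .a) = -(qC q • gen q .cStar) ∧
    E q (gen q .aStar) = 0 ∧ E q (gen q .c) = gen q .aStar ∧ E q (gen q .cStar) = 0 := by
  simp [E]

theorem F_gen (q : DefParam) : F q (gen q .a) = 0 ∧ F q (gen q .aStar) = gen q .c ∧
    F q (gen q .c) = 0 ∧ F q (gen q .cStar) = -((qC q)⁻¹ • gen q .a) := by
  simp [F]

theorem E_algebraMap (q : DefParam) (z : ℂ) : E q (algebraMap ℂ _ z) = 0 := by
  simp [E, Matrix.algebraMap_matrix_apply]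

theorem F_algebraMap (q : DefParam) (z : ℂ) : F q (algebraMap ℂ _ z) = 0 := by
  simp [F, Matrix.algebraMap_matrix_apply]

/-- The left action of `X₊ = q^(1/2) E K`. -/
noncomputable def Xplus (q : DefParam) : SUq q →ₗ[ℂ] SUq q :=
  qHalf q • (E q ∘ₗ (K q).toLinearMap)

/-- The left action of `X₋ = q^(-1/2) F K`. -/
noncomputable def Xminus (q : DefParam) : SUq q →ₗ[ℂ] SUq q :=
  (qHalf q)⁻¹ • (F q ∘ₗ (K q).toLinearMap)

theorem scale_comm (q : DefParam) (s t : ℂˣ) (x : SUq q) :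
    scale q s (scale q t x) = scale q t (scale q s x) := by
  induction x using induction with
  | hs z => simp only [AlgHom.commutes]
  | hg g => cases g <;> simp [scale, smul_smul, mul_comm]
  | hm x y hx hy => simp only [map_mul, hx, hy]
  | ha x y hx hy => simp only [map_add, hx, hy]

theorem scale_E (q : DefParam) (t : ℂˣ) (x : SUq q) :
    scale q t (E q x) = ((t : ℂ)⁻¹ ^ 2) • E q (scale q t x) := by
  have e := E_gen q
  have t0 := t.ne_zero
  induction x using induction with
  | hs z => simp only [AlgHom.commutes, E_algebraMap, map_zero, smul_zero]
  | hg g =>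
    cases g <;> simp [e, scale, smul_smul] <;> match_scalars <;> field_simp
  | hm x y hx hy =>
    simp only [map_mul, map_add, E_mul, hx, hy, Kinv, K, scale_comm q t, smul_add,
      mul_smul_comm, smul_mul_assoc]
  | ha x y hx hy => simp only [map_add, hx, hy, smul_add]

theorem scale_F (q : DefParam) (t : ℂˣ) (x : SUq q) :
    scale q t (F q x) = ((t : ℂ) ^ 2) • F q (scale q t x) := by
  have e := F_gen q
  have t0 := t.ne_zero
  induction x using induction with
  | hs z => simp only [AlgHom.commutes, F_algebraMap, map_zero, smul_zero]
  | hg g =>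
    cases g <;> simp [e, scale, smul_smul] <;> match_scalars <;> field_simp
  | hm x y hx hy =>
    simp only [map_mul, map_add, F_mul, hx, hy, Kinv, K, scale_comm q t, smul_add,
      mul_smul_comm, smul_mul_assoc]
  | ha x y hx hy => simp only [map_add, hx, hy, smul_add]

theorem α_Xplus (q : DefParam) (z : Circle) (x : SUq q) :
    α q z (Xplus q x) = ((z : ℂ) ^ (-2 : ℤ)) • Xplus q (α q z x) := by
  simp only [α, Xplus, K, LinearMap.smul_apply, LinearMap.comp_apply, AlgHom.toLinearMap_apply,
    map_smul, scale_E, scale_comm q (Circle.toUnits z), smul_comm _ (qHalf q)]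
  simp

theorem α_Xminus (q : DefParam) (z : Circle) (x : SUq q) :
    α q z (Xminus q x) = ((z : ℂ) ^ (-(-2) : ℤ)) • Xminus q (α q z x) := by
  simp only [α, Xminus, K, LinearMap.smul_apply, LinearMap.comp_apply, AlgHom.toLinearMap_apply,
    map_smul, scale_F, scale_comm q (Circle.toUnits z), smul_comm _ (qHalf q)⁻¹]
  simp

theorem α_star (q : DefParam) (z : Circle) (x : SUq q) : α q z (star x) = star (α q z x) := by
  induction x using induction with
  | hs w => simp only [Algebra.algebraMap_eq_smul_one, map_smul, map_one, star_smul, star_one]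
  | hg g => cases g <;> simp [α, scale, ← Circle.coe_inv_eq_conj]
  | hm x y hx hy => simp only [map_mul, star_mul, hx, hy]
  | ha x y hx hy => simp only [map_add, star_add, hx, hy]

end SUq

open SUq

/-- The coordinate algebra `A(CP¹_q)` of the quantum projective line: the `U(1)`-invariant elements
of `A(SU_q(2))`. -/
noncomputable def CP (q : DefParam) : StarSubalgebra ℂ (SUq q) where
  carrier := {x | ∀ z : Circle, α q z x = x}
  mul_mem' hx hy z := by rw [map_mul, hx z, hy z]
  add_mem' hx hy z := by rw [map_add, hx z, hy z]
  algebraMap_mem' r z := (α q z).commutes r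
  star_mem' hx z := by rw [α_star, hx z]

/-- The line bundle `L_n = {x | α_z(x) = x (z*)^n for all z in U(1)}`, as a left
`A(CP¹_q)`-module. -/
noncomputable def L (q : DefParam) (n : ℤ) : Submodule (CP q) (SUq q) where
  carrier := {x | ∀ z : Circle, α q z x = ((z : ℂ) ^ (-n)) • x}
  add_mem' hx hy z := by rw [map_add, hx z, hy z, smul_add]
  zero_mem' z := by rw [map_zero, smul_zero]
  smul_mem' f x hx z := by
    change α q z ((f : SUq q) * x) = _ • ((f : SUq q) * x)
    rw [map_mul, hx z, f.2 z, mul_smul_comm]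

theorem mul_mem_CP {q : DefParam} {n m : ℤ} (h : n + m = 0) {x y : SUq q} (hx : x ∈ L q n)
    (hy : y ∈ L q m) : x * y ∈ CP q := by
  intro z
  have hz : (z : ℂ) ≠ 0 := Circle.coe_ne_zero z
  rw [map_mul, hx z, hy z, smul_mul_smul_comm, ← zpow_add₀ hz, ← neg_add, h, neg_zero, zpow_zero,
    one_smul]

end QuantumProjectiveLine

namespace QuantumProjectiveLine
open SUq

/-! ### The Haar state -/

/-- Finitely supported vectors with basis `e n k`, `n ∈ ℕ`, `k ∈ ℤ`. -/
abbrev V : Type := (ℕ × ℤ) →₀ ℂ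

/-- The basis vectors. -/
noncomputable def e (n : ℕ) (k : ℤ) : V := Finsupp.single (n, k) 1

/-- The number `√(1 - q^(2n))`. -/
noncomputable def wt (q : DefParam) (n : ℕ) : ℂ := ((Real.sqrt (1 - (q : ℝ) ^ (2 * n)) : ℝ) : ℂ)

/-- `a e_{n,k} = √(1 - q^(2n)) e_{n-1,k}` (which is `0` for `n = 0`). -/
noncomputable def opA (q : DefParam) : Module.End ℂ V :=
  Finsupp.linearCombination ℂ fun p => wt q p.1 • e (p.1 - 1) p.2

/-- `a* e_{n,k} = √(1 - q^(2n+2)) e_{n+1,k}`. -/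
noncomputable def opAStar (q : DefParam) : Module.End ℂ V :=
  Finsupp.linearCombination ℂ fun p => wt q (p.1 + 1) • e (p.1 + 1) p.2

/-- `c e_{n,k} = q^n e_{n,k+1}`. -/
noncomputable def opC (q : DefParam) : Module.End ℂ V :=
  Finsupp.linearCombination ℂ fun p => qC q ^ p.1 • e p.1 (p.2 + 1)

/-- `c* e_{n,k} = q^n e_{n,k-1}`. -/
noncomputable def opCStar (q : DefParam) : Module.End ℂ V :=
  Finsupp.linearCombination ℂ fun p => qC q ^ p.1 • e p.1 (p.2 - 1)

theorem opA_e (q : DefParam) (n : ℕ) (k : ℤ) : opA q (e n k) = wt q n • e (n - 1) k := by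
  simp [opA, e]

theorem opAStar_e (q : DefParam) (n : ℕ) (k : ℤ) :
    opAStar q (e n k) = wt q (n + 1) • e (n + 1) k := by
  simp [opAStar, e]

theorem opC_e (q : DefParam) (n : ℕ) (k : ℤ) : opC q (e n k) = qC q ^ n • e n (k + 1) := by
  simp [opC, e]

theorem opCStar_e (q : DefParam) (n : ℕ) (k : ℤ) :
    opCStar q (e n k) = qC q ^ n • e n (k - 1) := by
  simp [opCStar, e]

theorem wt_zero (q : DefParam) : wt q 0 = 0 := by simp [wt]

theorem wt_mul_self (q : DefParam) (n : ℕ) : wt q n * wt q n = 1 - qC q ^ (2 * n) := by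
  have h : 0 ≤ 1 - (q : ℝ) ^ (2 * n) := sub_nonneg.2 (pow_le_one₀ q.2.1.le q.2.2.le)
  rw [wt, ← Complex.ofReal_mul, Real.mul_self_sqrt h, qC]
  push_cast; rfl

theorem norm_wt_le (q : DefParam) (n : ℕ) : ‖wt q n‖ ≤ 1 := by
  rw [wt, Complex.norm_real, Real.norm_of_nonneg (Real.sqrt_nonneg _)]
  exact Real.sqrt_le_one.2 (sub_le_self _ (pow_nonneg q.2.1.le _))

theorem norm_qC (q : DefParam) : ‖qC q‖ = (q : ℝ) := by
  rw [qC, Complex.norm_real, Real.norm_of_nonneg q.2.1.le]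

theorem norm_qC_pow_le (q : DefParam) (n : ℕ) : ‖qC q ^ n‖ ≤ 1 := by
  rw [norm_pow, norm_qC]; exact pow_le_one₀ q.2.1.le q.2.2.le

theorem end_ext {S T : Module.End ℂ V} (h : ∀ n k, S (e n k) = T (e n k)) : S = T := by
  refine Finsupp.lhom_ext' fun p => LinearMap.ext_ring ?_
  simpa [e] using h p.1 p.2

theorem relations_rep (q : DefParam) :
    Relations q (opA q) (opAStar q) (opC q) (opCStar q) := by
  constructor <;> refine end_ext fun n k => ?_ <;> rcases n with _ | n <;>
    simp [opA_e, opAStar_e, opC_e, opCStar_e, wt_zero, smul_smul] <;>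
    (try simp only [← add_smul, wt_mul_self]) <;> match_scalars <;> ring

/-- The representation of `A(SU_q(2))` by weighted shifts. -/
noncomputable def rep (q : DefParam) : SUq q →ₐ[ℂ] Module.End ℂ V := lift (relations_rep q)

/-- The matrix coefficient `⟨e_{m,l}, x e_{n,k}⟩`. -/
noncomputable def coeff (q : DefParam) (m : ℕ) (l : ℤ) (n : ℕ) (k : ℤ) : SUq q →ₗ[ℂ] ℂ where
  toFun x := rep q x (e n k) (m, l)
  map_add' x y := by simp
  map_smul' z x := by simp

/-- The `ℓ¹` norm of a finitely supported vector. -/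
noncomputable def l1 (v : V) : ℝ := v.sum fun _ z => ‖z‖

theorem l1_add_le (v w : V) : l1 (v + w) ≤ l1 v + l1 w := by
  classical
  have h (u : V) (hu : u.support ⊆ v.support ∪ w.support) :
      l1 u = ∑ p ∈ v.support ∪ w.support, ‖u p‖ :=
    Finsupp.sum_of_support_subset _ hu _ (by simp)
  rw [h v Finset.subset_union_left, h w Finset.subset_union_right, h _ Finsupp.support_add,
    ← Finset.sum_add_distrib]
  exact Finset.sum_le_sum fun p _ => norm_add_le _ _

theorem l1_smul (z : ℂ) (v : V) : l1 (z • v) = ‖z‖ * l1 v := by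
  rw [l1, Finsupp.sum_of_support_subset _ Finsupp.support_smul _ (by simp), l1, Finsupp.sum,
    Finset.mul_sum]
  exact Finset.sum_congr rfl fun p _ => by simp

theorem l1_e (n : ℕ) (k : ℤ) : l1 (e n k) = 1 := by simp [l1, e]

theorem norm_apply_le_l1 (v : V) (p : ℕ × ℤ) : ‖v p‖ ≤ l1 v := by
  by_cases h : p ∈ v.support
  · exact Finset.single_le_sum (f := fun p => ‖v p‖) (fun _ _ => norm_nonneg _) h
  · rw [Finsupp.notMem_support_iff.1 h, norm_zero]
    exact Finset.sum_nonneg fun _ _ => norm_nonneg _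

theorem l1_le_of_basis {T : Module.End ℂ V} {C : ℝ} (h : ∀ n k, l1 (T (e n k)) ≤ C) (v : V) :
    l1 (T v) ≤ C * l1 v := by
  induction v using Finsupp.induction with
  | zero => simp [l1]
  | single_add p z v hp hz ih =>
    have h1 : Finsupp.single p z = z • e p.1 p.2 := by simp [e]
    have h2 : l1 (Finsupp.single p z + v) = ‖z‖ + l1 v := by
      rw [l1, Finsupp.sum_add_index_of_disjoint, Finsupp.sum_single_index (by simp)]; rfl
      rw [Finsupp.support_single _ hz]; simpa using hp
    rw [h2, map_add, h1, map_smul]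
    refine (l1_add_le _ _).trans ?_
    rw [l1_smul, mul_add]
    have := mul_le_mul_of_nonneg_left (h p.1 p.2) (norm_nonneg z)
    linarith

theorem exists_l1_bound (q : DefParam) (x : SUq q) : ∃ C, 0 ≤ C ∧ ∀ v, l1 (rep q x v) ≤ C * l1 v := by
  induction x using SUq.induction with
  | hs z => exact ⟨‖z‖, norm_nonneg z, fun v => by simp [Module.algebraMap_end_apply, l1_smul]⟩
  | hg g =>
    refine ⟨1, zero_le_one, l1_le_of_basis fun n k => ?_⟩
    cases g <;> simp only [rep, lift_a, lift_aStar, lift_c, lift_cStar, opA_e, opAStar_e, opC_e,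
      opCStar_e, l1_smul, l1_e, mul_one, norm_wt_le, norm_qC_pow_le]
  | hm x y hx hy =>
    obtain ⟨C, hC, hx⟩ := hx
    obtain ⟨D, hD, hy⟩ := hy
    refine ⟨C * D, mul_nonneg hC hD, fun v => ?_⟩
    rw [map_mul, Module.End.mul_apply, mul_assoc]
    exact (hx _).trans (mul_le_mul_of_nonneg_left (hy v) hC)
  | ha x y hx hy =>
    obtain ⟨C, hC, hx⟩ := hx
    obtain ⟨D, hD, hy⟩ := hy
    refine ⟨C + D, add_nonneg hC hD, fun v => ?_⟩
    rw [map_add, LinearMap.add_apply, add_mul]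
    exact (l1_add_le _ _).trans (add_le_add (hx v) (hy v))

theorem exists_coeff_bound (q : DefParam) (x : SUq q) :
    ∃ C, ∀ m l n k, ‖coeff q m l n k x‖ ≤ C := by
  obtain ⟨C, -, h⟩ := exists_l1_bound q x
  refine ⟨C, fun m l n k => (norm_apply_le_l1 _ _).trans ?_⟩
  simpa [l1_e] using h (e n k)

theorem summable_haar (q : DefParam) (x : SUq q) :
    Summable fun n : ℕ => qC q ^ (2 * n) * coeff q n 0 n 0 x := by
  obtain ⟨C, h⟩ := exists_coeff_bound q x
  have hq : (q : ℝ) ^ 2 < 1 := pow_lt_one₀ q.2.1.le q.2.2 two_ne_zero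
  refine Summable.of_norm_bounded
    ((summable_geometric_of_lt_one (sq_nonneg (q : ℝ)) hq).mul_right C) fun n => ?_
  rw [norm_mul, norm_pow, norm_qC, pow_mul]
  exact mul_le_mul_of_nonneg_left (h n 0 n 0) (pow_nonneg (sq_nonneg _) _)

/-- The Haar state of `SU_q(2)`, by Woronowicz's formula
`h(x) = (1 - q²) ∑ₙ q^(2n) ⟨e_{n,0}, x e_{n,0}⟩`. The sum converges absolutely (`summable_haar`),
and the functional is normalized and invariant (`haar_one`, `haar_K`, `haar_E`, `haar_F` below). -/
noncomputable def haar (q : DefParam) : SUq q →ₗ[ℂ] ℂ where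
  toFun x := (1 - qC q ^ 2) * ∑' n : ℕ, qC q ^ (2 * n) * coeff q n 0 n 0 x
  map_add' x y := by
    simp only [map_add, mul_add, (summable_haar q x).tsum_add (summable_haar q y)]
  map_smul' z x := by
    simp only [map_smul, smul_eq_mul, RingHom.id_apply, mul_left_comm _ z, tsum_mul_left]

theorem one_sub_qC_sq_ne_zero (q : DefParam) : 1 - qC q ^ 2 ≠ 0 := by
  intro h
  have h1 : ‖qC q ^ 2‖ < 1 := by
    rw [norm_pow, norm_qC]; exact pow_lt_one₀ q.2.1.le q.2.2 two_ne_zero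
  rw [← sub_eq_zero.1 h, norm_one] at h1
  exact lt_irrefl _ h1

theorem haar_one (q : DefParam) : haar q 1 = 1 := by
  have h1 : ‖qC q ^ 2‖ < 1 := by
    rw [norm_pow, norm_qC]; exact pow_lt_one₀ q.2.1.le q.2.2 two_ne_zero
  simp [haar, coeff, e, pow_mul, tsum_geometric_of_norm_lt_one h1, one_sub_qC_sq_ne_zero q]

/-! Invariance of the functional: `h(K ▷ x) = h(x)`, `h(E ▷ x) = 0`, `h(F ▷ x) = 0`. With `h(1) = 1`
this characterizes the Haar state. -/

/-- Intertwiner for the rescaling automorphisms: `e_{n,k} ↦ t^(k-n) e_{n,k}`. -/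
noncomputable def opG (t : ℂˣ) : Module.End ℂ V :=
  Finsupp.linearCombination ℂ fun p => (t : ℂ) ^ (p.2 - (p.1 : ℤ)) • e p.1 p.2

theorem opG_e (t : ℂˣ) (n : ℕ) (k : ℤ) : opG t (e n k) = (t : ℂ) ^ (k - (n : ℤ)) • e n k := by
  simp [opG, e]

theorem apply_eq {S : Module.End ℂ V} {m n : ℕ} {l k : ℤ} {z : ℂ}
    (h : ∀ n' k', S (e n' k') (m, l) = z * e n' k' (n, k)) (v : V) :
    S v (m, l) = z * v (n, k) := by
  have : Finsupp.lapply (R := ℂ) (m, l) ∘ₗ S = z • Finsupp.lapply (R := ℂ) (M := ℂ) (n, k) := by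
    refine Finsupp.lhom_ext' fun p => LinearMap.ext_ring ?_
    simpa [e] using h p.1 p.2
  exact LinearMap.congr_fun this v

theorem opG_apply (t : ℂˣ) (v : V) (m : ℕ) (l : ℤ) :
    opG t v (m, l) = (t : ℂ) ^ (l - (m : ℤ)) * v (m, l) := by
  refine apply_eq (fun n k => ?_) v
  rw [opG_e]
  by_cases h : (n, k) = (m, l)
  · obtain ⟨rfl, rfl⟩ := Prod.mk.inj h; simp
  · simp [e, h]

theorem rep_scale (q : DefParam) (t : ℂˣ) (x : SUq q) :
    rep q (scale q t x) * opG t = opG t * rep q x := by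
  have t0 := t.ne_zero
  induction x using SUq.induction with
  | hs z => simp only [AlgHom.commutes]; exact Algebra.commutes z _
  | hg g =>
    refine end_ext fun n k => ?_
    cases g <;> rcases n with _ | n <;>
      simp [scale, rep, opA_e, opAStar_e, opC_e, opCStar_e, opG_e, smul_smul, wt_zero] <;>
      match_scalars <;> simp only [zpow_add₀ t0, zpow_sub₀ t0, zpow_one, zpow_natCast] <;>
      field_simp
  | hm x y hx hy => rw [map_mul, map_mul, map_mul, mul_assoc, hy, ← mul_assoc, hx, mul_assoc]
  | ha x y hx hy => rw [map_add, map_add, map_add, add_mul, mul_add, hx, hy]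

theorem coeff_scale (q : DefParam) (t : ℂˣ) (x : SUq q) (m n : ℕ) (l k : ℤ) :
    coeff q m l n k (scale q t x) = (t : ℂ) ^ ((n : ℤ) - m + l - k) * coeff q m l n k x := by
  have h := DFunLike.congr_fun (LinearMap.congr_fun (rep_scale q t x) (e n k)) (m, l)
  rw [Module.End.mul_apply, Module.End.mul_apply, opG_apply, opG_e, map_smul, Finsupp.smul_apply,
    smul_eq_mul] at h
  have t1 : (t : ℂ) ^ (k - (n : ℤ)) ≠ 0 := zpow_ne_zero _ t.ne_zero
  have t2 : (t : ℂ) ^ (l - (m : ℤ)) =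
      (t : ℂ) ^ (k - (n : ℤ)) * (t : ℂ) ^ ((n : ℤ) - m + l - k) := by
    rw [← zpow_add₀ t.ne_zero]; congr 1; ring
  rw [t2, mul_assoc] at h
  exact mul_left_cancel₀ t1 h

/-- The shift `e_{n,k} ↦ e_{n,k+1}`. -/
noncomputable def opS : Module.End ℂ V :=
  Finsupp.linearCombination ℂ fun p => e p.1 (p.2 + 1)

theorem opS_e (n : ℕ) (k : ℤ) : opS (e n k) = e n (k + 1) := by simp [opS, e]

theorem rep_shift (q : DefParam) (x : SUq q) : rep q x * opS = opS * rep q x := by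
  induction x using SUq.induction with
  | hs z => simp only [AlgHom.commutes]; exact Algebra.commutes z _
  | hg g =>
    refine end_ext fun n k => ?_
    cases g <;> simp [rep, opA_e, opAStar_e, opC_e, opCStar_e, opS_e]
  | hm x y hx hy => rw [map_mul, mul_assoc, hy, ← mul_assoc, hx, mul_assoc]
  | ha x y hx hy => rw [map_add, add_mul, mul_add, hx, hy]

theorem coeff_shift (q : DefParam) (x : SUq q) (m n : ℕ) (l k : ℤ) :
    coeff q m (l + 1) n (k + 1) x = coeff q m l n k x := by
  have h := DFunLike.congr_fun (LinearMap.congr_fun (rep_shift q x) (e n k)) (m, l + 1)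
  rw [Module.End.mul_apply, Module.End.mul_apply, opS_e] at h
  refine h.trans ?_
  rw [← one_mul (coeff q m l n k x)]
  refine apply_eq (fun n' k' => ?_) _
  rw [opS_e, one_mul, e, e, Finsupp.single_apply, Finsupp.single_apply]
  simp

theorem haar_K (q : DefParam) (x : SUq q) : haar q (K q x) = haar q x := by
  simp [haar, K, coeff_scale]

/-- `e_{n,k} ↦ q^(-n) √(1 - q^(2n+2)) e_{n+1,k-1}`, a multiple of which implements `E`. -/
noncomputable def opY (q : DefParam) : Module.End ℂ V :=
  Finsupp.linearCombination ℂ fun p =>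
    ((qC q)⁻¹ ^ p.1 * wt q (p.1 + 1)) • e (p.1 + 1) (p.2 - 1)

/-- `e_{n,k} ↦ q^(-n) √(1 - q^(2n)) e_{n-1,k+1}`, a multiple of which implements `F`. -/
noncomputable def opZ (q : DefParam) : Module.End ℂ V :=
  Finsupp.linearCombination ℂ fun p => ((qC q)⁻¹ ^ p.1 * wt q p.1) • e (p.1 - 1) (p.2 + 1)

theorem opY_e (q : DefParam) (n : ℕ) (k : ℤ) :
    opY q (e n k) = ((qC q)⁻¹ ^ n * wt q (n + 1)) • e (n + 1) (k - 1) := by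
  simp [opY, e]

theorem opZ_e (q : DefParam) (n : ℕ) (k : ℤ) :
    opZ q (e n k) = ((qC q)⁻¹ ^ n * wt q n) • e (n - 1) (k + 1) := by
  simp [opZ, e]

theorem opY_apply (q : DefParam) (v : V) (m : ℕ) (l : ℤ) :
    opY q v (m, l) = ((qC q)⁻¹ ^ (m - 1) * wt q m) * v (m - 1, l + 1) := by
  refine apply_eq (fun n k => ?_) v
  rw [opY_e]
  rcases m with _ | m
  · simp [e, wt_zero]
  · by_cases h : (n, k) = (m, l + 1)
    · obtain ⟨rfl, rfl⟩ := Prod.mk.inj h; simp [e]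
    · have h' : ¬ (n = m ∧ k - 1 = l) := fun h' => h (by rw [h'.1, ← h'.2]; simp)
      simp [e, h, h']

theorem opZ_apply (q : DefParam) (v : V) (m : ℕ) (l : ℤ) :
    opZ q v (m, l) = ((qC q)⁻¹ ^ (m + 1) * wt q (m + 1)) * v (m + 1, l - 1) := by
  refine apply_eq (fun n k => ?_) v
  rw [opZ_e]
  rcases n with _ | n
  · simp [e, wt_zero]
  · by_cases h : (n, k) = (m, l - 1)
    · obtain ⟨rfl, rfl⟩ := Prod.mk.inj h; simp [e]
    · have h' : ¬ (n = m ∧ k + 1 = l) := fun h' => h (by rw [h'.1, ← h'.2]; simp)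
      have h2 : ¬ (n = m ∧ k = l - 1) := fun h2 => h (by rw [h2.1, h2.2])
      simp [e, h', h2]

theorem rep_E (q : DefParam) (x : SUq q) :
    (qC q ^ 2 - 1) • rep q (E q x) =
      qHalf q • (rep q (Kinv q x) * opY q - opY q * rep q (K q x)) := by
  induction x using SUq.induction with
  | hs z =>
    simp only [AlgHom.commutes, E_algebraMap, map_zero, smul_zero]
    rw [Algebra.commutes, sub_self (opY q * _), smul_zero]
  | hg g =>
    have h0 := qC_ne_zero q
    have r := qHalf_mul_self q
    have r0 := qHalf_ne_zero q
    have w (m : ℕ) : wt q m ^ 2 = 1 - (qHalf q ^ 2) ^ (2 * m) := by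
      rw [sq, sq, wt_mul_self, r]
    refine end_ext fun n k => ?_
    cases g <;> rcases n with _ | n <;>
      simp [E_gen q, K, Kinv, scale, rep, opA_e, opAStar_e, opC_e, opCStar_e, opY_e, smul_smul,
        wt_zero]
    all_goals try simp only [← r]
    all_goals match_scalars <;> field_simp <;> (try simp only [w]) <;> ring
  | hm x y hx hy =>
    rw [E_mul, map_add, map_mul, map_mul, smul_add, ← mul_smul_comm, ← smul_mul_assoc, hx, hy,
      map_mul, map_mul, map_mul, map_mul]
    simp only [mul_smul_comm, smul_mul_assoc, ← smul_add]
    congr 1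
    refine LinearMap.ext fun v => ?_
    simp
  | ha x y hx hy =>
    rw [map_add, map_add, smul_add, hx, hy, ← smul_add]
    congr 1
    simp only [map_add, add_mul, mul_add]; abel

theorem rep_F (q : DefParam) (x : SUq q) :
    (qC q ^ 2 - 1) • rep q (F q x) =
      qHalf q • (rep q (Kinv q x) * opZ q - opZ q * rep q (K q x)) := by
  induction x using SUq.induction with
  | hs z =>
    simp only [AlgHom.commutes, F_algebraMap, map_zero, smul_zero]
    rw [Algebra.commutes, sub_self (opZ q * _), smul_zero]
  | hg g =>
    have h0 := qC_ne_zero q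
    have r := qHalf_mul_self q
    have r0 := qHalf_ne_zero q
    have w (m : ℕ) : wt q m ^ 2 = 1 - (qHalf q ^ 2) ^ (2 * m) := by
      rw [sq, sq, wt_mul_self, r]
    refine end_ext fun n k => ?_
    cases g <;> rcases n with _ | n <;>
      simp [F_gen q, K, Kinv, scale, rep, opA_e, opAStar_e, opC_e, opCStar_e, opZ_e, smul_smul,
        wt_zero]
    all_goals try simp only [← r]
    all_goals match_scalars <;> field_simp <;> (try simp only [w]) <;> ring
  | hm x y hx hy =>
    rw [F_mul, map_add, map_mul, map_mul, smul_add, ← mul_smul_comm, ← smul_mul_assoc, hx, hy,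
      map_mul, map_mul, map_mul, map_mul]
    simp only [mul_smul_comm, smul_mul_assoc, ← smul_add]
    congr 1
    refine LinearMap.ext fun v => ?_
    simp
  | ha x y hx hy =>
    rw [map_add, map_add, smul_add, hx, hy, ← smul_add]
    congr 1
    simp only [map_add, add_mul, mul_add]; abel


theorem tsum_telescope (q : DefParam) {f t : ℕ → ℂ} {z : ℂ} (hf : Summable f) (h0 : f 0 = 0)
    (h : ∀ n, (qC q ^ 2 - 1) * t n = z * (f (n + 1) - f n)) :
    (1 - qC q ^ 2) * ∑' n, t n = 0 := by
  have h1 := hf.tsum_eq_zero_add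
  rw [h0, zero_add] at h1
  have h2 : ∑' n, (f (n + 1) - f n) = 0 := by
    rw [((summable_nat_add_iff 1).2 hf).tsum_sub hf, ← h1, sub_self]
  rw [← neg_sub, neg_mul, ← tsum_mul_left, tsum_congr h, tsum_mul_left, h2, mul_zero, neg_zero]

theorem summable_aux (q : DefParam) {g : ℕ → ℂ} {C : ℝ} (h : ∀ n, ‖g n‖ ≤ C) :
    Summable fun n => qC q ^ n * wt q n * g n := by
  refine Summable.of_norm_bounded
    ((summable_geometric_of_lt_one q.2.1.le q.2.2).mul_right C) fun n => ?_
  rw [norm_mul, norm_mul, norm_pow, norm_qC]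
  refine mul_le_mul ?_ (h n) (norm_nonneg _) (pow_nonneg q.2.1.le _)
  exact mul_le_of_le_one_right (pow_nonneg q.2.1.le _) (norm_wt_le q n)

theorem haar_E (q : DefParam) (x : SUq q) : haar q (E q x) = 0 := by
  have h0 := qC_ne_zero q
  have r := qHalf_mul_self q
  obtain ⟨C, hC⟩ := exists_coeff_bound q x
  refine tsum_telescope q (f := fun n => qC q ^ n * wt q n * coeff q (n - 1) 1 n 0 x)
    (z := qHalf q) (summable_aux q fun n => hC _ _ _ _) (by simp [wt_zero]) fun n => ?_
  have h := DFunLike.congr_fun (LinearMap.congr_fun (rep_E q x) (e n 0)) (n, 0)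
  have h1 : coeff q n 0 (n + 1) (-1) (Kinv q x) = qC q * coeff q n 1 (n + 1) 0 x := by
    rw [Kinv, coeff_scale, ← coeff_shift q x n (n + 1) 0 (-1)]
    congr 1
    rw [Units.val_mk0, ← r, ← sq, ← zpow_natCast]; congr 1; push_cast; ring
  have h2 : wt q n * coeff q (n - 1) 1 n 0 (K q x) =
      wt q n * ((qC q)⁻¹ * coeff q (n - 1) 1 n 0 x) := by
    rcases n with _ | n
    · simp [wt_zero]
    · rw [K, coeff_scale]
      congr 2
      rw [Units.val_inv_eq_inv_val, Units.val_mk0, ← r, ← sq, ← inv_pow, ← zpow_natCast]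
      congr 1; push_cast; simp
  have h3 : (rep q (Kinv q x) * opY q) (e n 0) (n, 0) =
      (qC q)⁻¹ ^ n * wt q (n + 1) * coeff q n 0 (n + 1) (-1) (Kinv q x) := by
    rw [Module.End.mul_apply, opY_e, map_smul]; rfl
  have h4 : (opY q * rep q (K q x)) (e n 0) (n, 0) =
      (qC q)⁻¹ ^ (n - 1) * (wt q n * coeff q (n - 1) 1 n 0 (K q x)) := by
    rw [Module.End.mul_apply, opY_apply, ← mul_assoc]; rfl
  have h5 : (qC q ^ 2 - 1) * coeff q n 0 n 0 (E q x) = qHalf q *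
      ((rep q (Kinv q x) * opY q) (e n 0) (n, 0) - (opY q * rep q (K q x)) (e n 0) (n, 0)) := h
  rw [h3, h4, h1, h2] at h5
  rw [mul_left_comm, h5]
  rcases n with _ | n
  · simp [wt_zero]
    exact Or.inl (by ring)
  · simp only [Nat.add_sub_cancel, inv_pow, two_mul, pow_add, pow_one]
    have hn : qC q ^ n ≠ 0 := pow_ne_zero n h0
    field_simp

theorem haar_F (q : DefParam) (x : SUq q) : haar q (F q x) = 0 := by
  have h0 := qC_ne_zero q
  have r := qHalf_mul_self q
  obtain ⟨C, hC⟩ := exists_coeff_bound q x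
  refine tsum_telescope q (f := fun n => qC q ^ n * wt q n * coeff q n 0 (n - 1) 1 x)
    (z := -(qHalf q * (qC q)⁻¹)) (summable_aux q fun n => hC _ _ _ _) (by simp [wt_zero])
    fun n => ?_
  have h := DFunLike.congr_fun (LinearMap.congr_fun (rep_F q x) (e n 0)) (n, 0)
  have h1 : coeff q (n + 1) (-1) n 0 (K q x) = qC q * coeff q (n + 1) 0 n 1 x := by
    rw [K, coeff_scale, ← coeff_shift q x (n + 1) n (-1) 0]
    congr 1
    rw [Units.val_inv_eq_inv_val, Units.val_mk0, ← r, ← sq, inv_zpow', ← zpow_natCast]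
    congr 1; push_cast; ring
  have h2 : wt q n * coeff q n 0 (n - 1) 1 (Kinv q x) =
      wt q n * ((qC q)⁻¹ * coeff q n 0 (n - 1) 1 x) := by
    rcases n with _ | n
    · simp [wt_zero]
    · rw [Kinv, coeff_scale]
      congr 2
      rw [Units.val_mk0, ← r, ← sq, ← zpow_natCast, ← zpow_neg]
      congr 1; push_cast; simp
  have h3 : (rep q (Kinv q x) * opZ q) (e n 0) (n, 0) =
      (qC q)⁻¹ ^ n * (wt q n * coeff q n 0 (n - 1) 1 (Kinv q x)) := by
    rw [Module.End.mul_apply, opZ_e, map_smul, ← mul_assoc]; rfl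
  have h4 : (opZ q * rep q (K q x)) (e n 0) (n, 0) =
      (qC q)⁻¹ ^ (n + 1) * wt q (n + 1) * coeff q (n + 1) (-1) n 0 (K q x) := by
    rw [Module.End.mul_apply, opZ_apply]; rfl
  have h5 : (qC q ^ 2 - 1) * coeff q n 0 n 0 (F q x) = qHalf q *
      ((rep q (Kinv q x) * opZ q) (e n 0) (n, 0) - (opZ q * rep q (K q x)) (e n 0) (n, 0)) := h
  rw [h3, h4, h1, h2] at h5
  rw [mul_left_comm, h5]
  simp only [Nat.add_sub_cancel, inv_pow, two_mul, pow_add, pow_one]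
  have hn : qC q ^ n ≠ 0 := pow_ne_zero n h0
  field_simp
  ring

end QuantumProjectiveLine

namespace QuantumProjectiveLine
open SUq

/-! ### The two-dimensional calculus on the quantum projective line -/

/-- One-forms `Ω¹(CP¹_q) = L_{-2} ω₋ ⊕ L_{2} ω₊`: the pair `(x, y)` is `x ω₋ + y ω₊`. -/
abbrev Omega1 (q : DefParam) : Type := L q (-2) × L q 2

/-- Two-forms `Ω²(CP¹_q) = A(CP¹_q) ω₋ ∧ ω₊`: the element `f` is `f ω₋ ∧ ω₊`. -/
abbrev Omega2 (q : DefParam) : Type := CP q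

/-- The holomorphic differential `∂ f = (X₊ ▷ f) ω₊`. -/
noncomputable def del {q : DefParam} (f : CP q) : Omega1 q :=
  (0, ⟨Xplus q f, fun z => by rw [α_Xplus, f.2 z]⟩)

/-- The anti-holomorphic differential `∂̄ f = (X₋ ▷ f) ω₋`. -/
noncomputable def delbar {q : DefParam} (f : CP q) : Omega1 q :=
  (⟨Xminus q f, fun z => by rw [α_Xminus, f.2 z]⟩, 0)

/-- The exterior differential `d = ∂̄ + ∂` on functions. -/
noncomputable def d {q : DefParam} (f : CP q) : Omega1 q := delbar f + del f

/-- The Hodge operator on one-forms: `⋆ ω₊ = ω₊`, `⋆ ω₋ = -ω₋`. -/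
noncomputable def hodge {q : DefParam} (η : Omega1 q) : Omega1 q := (-η.1, η.2)

/-- The product of one-forms
`(x ω₋ + y ω₊) ∧ (t ω₋ + z ω₊) = (q² x z - y t) ω₋ ∧ ω₊`. It is forced by `ω₋ z = q² z ω₋` for
`z ∈ L_2` and `ω₊ t = q⁻² t ω₊` for `t ∈ L_{-2}` (a consequence of `ω_± a = q⁻¹ a ω_±`,
`ω_± a* = q a* ω_±`, `ω_± c = q⁻¹ c ω_±`, `ω_± c* = q c* ω_±`), together with
`ω₊ ∧ ω₋ = -q² ω₋ ∧ ω₊` and `ω₋ ∧ ω₋ = ω₊ ∧ ω₊ = 0`. -/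
noncomputable def wedge {q : DefParam} (η θ : Omega1 q) : Omega2 q :=
  (qC q ^ 2) • (⟨η.1 * θ.2, mul_mem_CP (by norm_num) η.1.2 θ.2.2⟩ : CP q) -
    ⟨η.2 * θ.1, mul_mem_CP (by norm_num) η.2.2 θ.1.2⟩

/-- The integral `∫_h f ω₋ ∧ ω₊ = h(f)`. -/
noncomputable def integral {q : DefParam} (f : Omega2 q) : ℂ := haar q f

/-! ### Matrix-valued forms and the quantum trace -/

/-- Square matrices of size `n + 1`. -/
abbrev Mat (n : ℕ) (R : Type) : Type := Matrix (Fin (n + 1)) (Fin (n + 1)) R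

/-- The product of a matrix of functions and a matrix of one-forms. -/
noncomputable def mulForm {q : DefParam} {n : ℕ} (M : Mat n (CP q)) (η : Mat n (Omega1 q)) :
    Mat n (Omega1 q) :=
  Matrix.of fun i j => ∑ k, M i k • η k j

/-- The product of two matrices of one-forms. -/
noncomputable def wedgeForm {q : DefParam} {n : ℕ} (η θ : Mat n (Omega1 q)) : Mat n (Omega2 q) :=
  Matrix.of fun i j => ∑ k, wedge (η i k) (θ k j)

/-- The matrix `π_{n/2}(K)` of the spin `n/2` representation, in the basis `|n/2, m⟩` with
`m = n/2, n/2 - 1, …, -n/2`: it is diagonal with entries `q^m`. -/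
noncomputable def spinK (q : DefParam) (n : ℕ) : Mat n ℂ :=
  Matrix.diagonal fun j => (((q : ℝ) ^ ((n : ℝ) / 2 - ((j : ℕ) : ℝ)) : ℝ) : ℂ)

/-- The quantum trace `qtr(M) = ∑_{j,l} M_{jl} (π_{n/2}(K²))_{lj}`. -/
noncomputable def qtr {q : DefParam} {n : ℕ} (M : Mat n (CP q)) : CP q :=
  ∑ j, ∑ l, (spinK q n ^ 2) l j • M j l

/-- A twisted sigma-model instanton: a projection `P` with `⋆ P dP = P dP`. -/
structure IsInstanton {q : DefParam} {n : ℕ} (P : Mat n (CP q)) : Prop where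
  isStarProjection : IsStarProjection P
  selfDual : (mulForm P (P.map d)).map hodge = mulForm P (P.map d)

/-- A twisted sigma-model anti-instanton: a projection `P` with `⋆ P dP = -P dP`. -/
structure IsAntiInstanton {q : DefParam} {n : ℕ} (P : Mat n (CP q)) : Prop where
  isStarProjection : IsStarProjection P
  antiSelfDual : (mulForm P (P.map d)).map hodge = -mulForm P (P.map d)

end QuantumProjectiveLine

namespace QuantumProjectiveLine
open SUq

/-! ### Faithfulness of the representation by weighted shifts -/

/-! The statement is a Bogomolny-type argument. Let `A` and `B` be the matrices of coefficients of
`∂P` and `∂̄P`. On `A(CP¹_q)` the element `K` acts trivially (`scale_eq_self`), so `X₊` is an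
untwisted derivation there and `P² = P` gives `A = PA + AP`, hence `PAP = 0`. The involution
exchanges `E` and `F` up to scalars, so `P* = P` gives `A* = -q² B` (`Xplus_star`).

Substituting `B = -q⁻² A*`, the coefficient of `P(⋆dP) ∧ dP` becomes `q⁻² P A A* + P A* A`, and that
of `P dP ∧ dP` becomes `q⁻² P A A* - P A* A`. The Haar state is not a trace, so cyclicity cannot be
used to symmetrize these products. It is not needed: `PAP = 0` gives `P A A* = (PA)(PA)*` and `P A*
A = (AP)*(AP)` (`mul_mul_eq_mul_mul_mul`). The two integrals are therefore `v + u` and `v - u` with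
`u, v ≥ 0` (`exists_energies`), whence the inequality. Equality means `u = 0` or `v = 0`.

To read `u = 0` as `P ∂̄P = 0` and `v = 0` as `P ∂P = 0`, the Haar state must be faithful on the
algebra given by generators and relations (`exists_haar_star_mul_self`). By its formula, `h(x* x)`
is a positively weighted sum of the `‖x e_{n,0}‖²`, so `h(x* x) = 0` makes `x` act by zero in the
weighted shift representation. That representation is injective (`rep_injective`): ordered monomials
span the algebra, and for large `n` their matrix entries are, up to nonzero factors, distinct powers
of `q^n`. -/

theorem mul_pow_of_mul_eq_smul {B : Type} [Ring B] [Algebra ℂ B] {x y : B} {t : ℂ}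
    (h : x * y = t • (y * x)) (n : ℕ) : x * y ^ n = t ^ n • (y ^ n * x) := by
  induction n with
  | zero => simp
  | succ n ih =>
    rw [pow_succ y n, ← mul_assoc, ih, smul_mul_assoc, mul_assoc, h, mul_smul_comm, smul_smul,
      ← mul_assoc, ← pow_succ]

/-- The ordered monomials `a^i c^j (c*)^k` for `i ≥ 0` and `(a*)^(-i) c^j (c*)^k` for `i ≤ 0`. -/
noncomputable def mon (q : DefParam) (p : ℤ × ℕ × ℕ) : SUq q :=
  gen q .a ^ p.1.toNat * gen q .aStar ^ (-p.1).toNat * (gen q .c ^ p.2.1 * gen q .cStar ^ p.2.2)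

/-- `c` commutes with `a` and `a*` up to scalars, so it reaches its place at the cost of one `q⁻¹`
for each `a` and one `q` for each `a*`. -/
theorem c_mul_mon (q : DefParam) (p : ℤ × ℕ × ℕ) :
    ∃ t : ℂ, gen q .c * mon q p = t • mon q (p.1, p.2.1 + 1, p.2.2) := by
  have h := relations q
  have h1 : gen q .c * gen q .a = (qC q)⁻¹ • (gen q .a * gen q .c) := by
    rw [h.a_c, smul_smul, inv_mul_cancel₀ (qC_ne_zero q), one_smul]
  refine ⟨(qC q)⁻¹ ^ p.1.toNat * qC q ^ (-p.1).toNat, ?_⟩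
  rw [mon, mon, mul_assoc (gen q .a ^ _), ← mul_assoc (gen q .c), mul_pow_of_mul_eq_smul h1,
    smul_mul_assoc, mul_assoc (_ ^ _) (gen q .c), ← mul_assoc (gen q .c) (gen q .aStar ^ _),
    mul_pow_of_mul_eq_smul h.c_aS]
  simp only [smul_mul_assoc, mul_smul_comm, smul_smul, pow_succ', mul_assoc]

theorem cStar_mul_mon (q : DefParam) (p : ℤ × ℕ × ℕ) :
    ∃ t : ℂ, gen q .cStar * mon q p = t • mon q (p.1, p.2.1, p.2.2 + 1) := by
  have h := relations q
  have h1 : gen q .cStar * gen q .a = (qC q)⁻¹ • (gen q .a * gen q .cStar) := by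
    rw [h.a_cS, smul_smul, inv_mul_cancel₀ (qC_ne_zero q), one_smul]
  have h2 : gen q .cStar * gen q .c ^ p.2.1 = gen q .c ^ p.2.1 * gen q .cStar :=
    Commute.pow_right h.c_cS.symm p.2.1
  refine ⟨(qC q)⁻¹ ^ p.1.toNat * qC q ^ (-p.1).toNat, ?_⟩
  rw [mon, mon, mul_assoc (gen q .a ^ _), ← mul_assoc (gen q .cStar), mul_pow_of_mul_eq_smul h1,
    smul_mul_assoc, mul_assoc (_ ^ _) (gen q .cStar), ← mul_assoc (gen q .cStar) (gen q .aStar ^ _),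
    mul_pow_of_mul_eq_smul h.cS_aS]
  simp only [smul_mul_assoc, mul_smul_comm, smul_smul, mul_assoc, pow_succ' _ p.2.2]
  rw [← mul_assoc (gen q .cStar), h2, mul_assoc]

theorem a_mul_mon_of_nonneg (q : DefParam) {p : ℤ × ℕ × ℕ} (hp : 0 ≤ p.1) :
    gen q .a * mon q p = mon q (p.1 + 1, p.2) := by
  have h1 : (p.1 + 1).toNat = p.1.toNat + 1 := by omega
  have h2 : (-(p.1 + 1)).toNat = 0 := by omega
  have h3 : (-p.1).toNat = 0 := by omega
  simp only [mon, h1, h2, h3, pow_succ', mul_assoc]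

theorem aStar_mul_mon_of_nonpos (q : DefParam) {p : ℤ × ℕ × ℕ} (hp : p.1 ≤ 0) :
    gen q .aStar * mon q p = mon q (p.1 - 1, p.2) := by
  have h1 : (-(p.1 - 1)).toNat = (-p.1).toNat + 1 := by omega
  have h2 : (p.1 - 1).toNat = 0 := by omega
  have h3 : p.1.toNat = 0 := by omega
  simp only [mon, h1, h2, h3, pow_succ', mul_assoc, pow_zero, one_mul]

/-- The new `a` meets an `a*`, and `a a* = 1 - q² c c*` removes both, leaving a monomial with one
`a*` fewer. The factors `c`, `c*` stay on the left, since multiplication by them is already under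
control. -/
theorem a_mul_mon_of_neg (q : DefParam) {p : ℤ × ℕ × ℕ} (hp : p.1 < 0) :
    gen q .a * mon q p = mon q (p.1 + 1, p.2) -
      qC q ^ 2 • (gen q .c * (gen q .cStar * mon q (p.1 + 1, p.2))) := by
  have h := aStar_mul_mon_of_nonpos q (p := (p.1 + 1, p.2)) (by simp; omega)
  simp only [add_sub_cancel_right] at h
  rw [← h, ← mul_assoc, eq_sub_iff_add_eq, ← mul_assoc, ← smul_mul_assoc, ← add_mul, (relations q).a_aS, one_mul]

theorem aStar_mul_mon_of_pos (q : DefParam) {p : ℤ × ℕ × ℕ} (hp : 0 < p.1) :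
    gen q .aStar * mon q p = mon q (p.1 - 1, p.2) -
      gen q .cStar * (gen q .c * mon q (p.1 - 1, p.2)) := by
  have h := a_mul_mon_of_nonneg q (p := (p.1 - 1, p.2)) (by simp; omega)
  simp only [sub_add_cancel] at h
  rw [← h, ← mul_assoc, eq_sub_iff_add_eq, ← mul_assoc, ← add_mul, (relations q).aS_a, one_mul]

theorem gen_mul_mem_span_mon (q : DefParam) (g : Gen) {x : SUq q}
    (hx : x ∈ Submodule.span ℂ (Set.range (mon q))) :
    gen q g * x ∈ Submodule.span ℂ (Set.range (mon q)) := by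
  set S := Submodule.span ℂ (Set.range (mon q))
  have hm (p) : mon q p ∈ S := Submodule.subset_span ⟨p, rfl⟩
  have ext {y : SUq q} (h : ∀ p, y * mon q p ∈ S) {x : SUq q} (hx : x ∈ S) : y * x ∈ S := by
    induction hx using Submodule.span_induction with
    | mem x hx => obtain ⟨p, rfl⟩ := hx; exact h p
    | zero => rw [mul_zero]; exact zero_mem _
    | add x y _ _ hx hy => rw [mul_add]; exact add_mem hx hy
    | smul t x _ hx => rw [mul_smul_comm]; exact S.smul_mem t hx
  have hc {x} (hx : x ∈ S) : gen q .c * x ∈ S := by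
    refine ext (fun p => ?_) hx
    obtain ⟨t, ht⟩ := c_mul_mon q p
    rw [ht]; exact S.smul_mem _ (hm _)
  have hd {x} (hx : x ∈ S) : gen q .cStar * x ∈ S := by
    refine ext (fun p => ?_) hx
    obtain ⟨t, ht⟩ := cStar_mul_mon q p
    rw [ht]; exact S.smul_mem _ (hm _)
  cases g with
  | c => exact hc hx
  | cStar => exact hd hx
  | a =>
    refine ext (fun p => ?_) hx
    rcases le_or_gt 0 p.1 with hp | hp
    · rw [a_mul_mon_of_nonneg q hp]; exact hm _
    · rw [a_mul_mon_of_neg q hp]; exact sub_mem (hm _) (S.smul_mem _ (hc (hd (hm _))))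
  | aStar =>
    refine ext (fun p => ?_) hx
    rcases le_or_gt p.1 0 with hp | hp
    · rw [aStar_mul_mon_of_nonpos q hp]; exact hm _
    · rw [aStar_mul_mon_of_pos q hp]; exact sub_mem (hm _) (hd (hc (hm _)))

theorem mem_span_mon (q : DefParam) (x : SUq q) :
    x ∈ Submodule.span ℂ (Set.range (mon q)) := by
  -- The induction is on the left factor, for all `y` in the span at once; the product step needs
  -- this generality. The span contains `1`, so stability under left multiplication makes it
  -- everything.
  suffices h : ∀ y ∈ Submodule.span ℂ (Set.range (mon q)),
      x * y ∈ Submodule.span ℂ (Set.range (mon q)) by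
    rw [← mul_one x]
    refine h 1 (Submodule.subset_span ⟨(0, 0, 0), ?_⟩)
    simp [mon]
  induction x using SUq.induction with
  | hs z => intro y hy; rw [← Algebra.smul_def]; exact Submodule.smul_mem _ _ hy
  | hg g => intro y hy; exact gen_mul_mem_span_mon q g hy
  | hm x y hx hy => intro z hz; rw [mul_assoc]; exact hx _ (hy _ hz)
  | ha x y hx hy => intro z hz; rw [add_mul]; exact add_mem (hx _ hz) (hy _ hz)

/-! ### Action of the ordered monomials on basis vectors -/

theorem wt_ne_zero (q : DefParam) {n : ℕ} (hn : n ≠ 0) : wt q n ≠ 0 := by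
  have h : (q : ℝ) ^ (2 * n) < 1 := pow_lt_one₀ q.2.1.le q.2.2 (by omega)
  exact Complex.ofReal_ne_zero.2 (Real.sqrt_pos.2 (sub_pos.2 h)).ne'

/-- The bound `i ≤ n` keeps the weights met on the way down away from `wt q 0 = 0`. The factor `W`
is chosen before `k`, as the weights depend only on the first index. -/
theorem opA_pow_e (q : DefParam) (i : ℕ) :
    ∀ n, i ≤ n → ∃ W : ℂ, W ≠ 0 ∧ ∀ k, (opA q ^ i) (e n k) = W • e (n - i) k := by
  induction i with
  | zero => exact fun n _ => ⟨1, one_ne_zero, fun k => by simp⟩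
  | succ i ih =>
    intro n hn
    obtain ⟨W, hW, h⟩ := ih (n - 1) (by omega)
    refine ⟨wt q n * W, mul_ne_zero (wt_ne_zero q (by omega)) hW, fun k => ?_⟩
    rw [pow_succ, Module.End.mul_apply, opA_e, map_smul, h, smul_smul, Nat.sub_sub, add_comm 1]

theorem opAStar_pow_e (q : DefParam) (i : ℕ) :
    ∀ n, ∃ W : ℂ, W ≠ 0 ∧ ∀ k, (opAStar q ^ i) (e n k) = W • e (n + i) k := by
  induction i with
  | zero => exact fun n => ⟨1, one_ne_zero, fun k => by simp⟩
  | succ i ih =>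
    intro n
    obtain ⟨W, hW, h⟩ := ih (n + 1)
    refine ⟨wt q (n + 1) * W, mul_ne_zero (wt_ne_zero q (by omega)) hW, fun k => ?_⟩
    rw [pow_succ, Module.End.mul_apply, opAStar_e, map_smul, h, smul_smul, add_assoc, add_comm 1]

theorem opC_pow_e (q : DefParam) (j n : ℕ) (k : ℤ) :
    (opC q ^ j) (e n k) = (qC q ^ n) ^ j • e n (k + j) := by
  induction j with
  | zero => simp
  | succ j ih =>
    rw [pow_succ', Module.End.mul_apply, ih, map_smul, opC_e, smul_smul, ← pow_succ]
    congr 2; push_cast; ring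

theorem opCStar_pow_e (q : DefParam) (j n : ℕ) (k : ℤ) :
    (opCStar q ^ j) (e n k) = (qC q ^ n) ^ j • e n (k - j) := by
  induction j with
  | zero => simp
  | succ j ih =>
    rw [pow_succ', Module.End.mul_apply, ih, map_smul, opCStar_e, smul_smul, ← pow_succ]
    congr 2; push_cast; ring

/-- `c` and `c*` act first, each contributing a factor `q^n`; the powers of `a` or `a*` then
contribute a factor independent of the second index. So `W` depends on `i` and `n` alone, and for
fixed `i` and `j - k` the monomials differ only by a power of `q^n`. -/
theorem rep_mon_e (q : DefParam) (i : ℤ) (n : ℕ) (hi : i ≤ n) :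
    ∃ W : ℂ, W ≠ 0 ∧ ∀ j k : ℕ, rep q (mon q (i, j, k)) (e n 0) =
      (W * (qC q ^ n) ^ (j + k)) • e (n - i).toNat ((j : ℤ) - k) := by
  obtain ⟨W₁, h₁, H₁⟩ := opAStar_pow_e q (-i).toNat n
  obtain ⟨W₂, h₂, H₂⟩ := opA_pow_e q i.toNat (n + (-i).toNat) (by omega)
  refine ⟨W₂ * W₁, mul_ne_zero h₂ h₁, fun j k => ?_⟩
  have hn : n + (-i).toNat - i.toNat = ((n : ℤ) - i).toNat := by omega
  simp only [mon, map_mul, map_pow, Module.End.mul_apply]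
  simp only [rep, lift_a, lift_aStar, lift_c, lift_cStar, opCStar_pow_e, opC_pow_e, map_smul, H₁,
    H₂, smul_smul, hn]
  congr 1
  · ring
  · congr 1; ring

theorem eq_zero_of_rep_sum_mon (q : DefParam) (f : (ℤ × ℕ × ℕ) →₀ ℂ)
    (h : rep q (Finsupp.linearCombination ℂ (mon q) f) = 0) : f = 0 := by
  classical
  ext p₀
  obtain ⟨i₀, j₀, k₀⟩ := p₀
  -- `T` collects the monomials in the support sending `e_{n,0}` to a multiple of the same basis
  -- vector as `(i₀, j₀, k₀)` does. The corresponding entry of the sum is `W` times the value of `Q`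
  -- at `q^n`.
  let T := f.support.filter fun p => p.1 = i₀ ∧ (p.2.1 : ℤ) - p.2.2 = (j₀ : ℤ) - k₀
  let Q : Polynomial ℂ := ∑ p ∈ T, Polynomial.monomial (p.2.1 + p.2.2) (f p)
  -- Beyond `N` no truncation occurs in `(n - i).toNat`, so different `i` give different target
  -- vectors. The index `i₀` is included because `(i₀, j₀, k₀)` may lie outside the support.
  obtain ⟨N, hN⟩ : ∃ N : ℕ, ∀ p ∈ insert (i₀, j₀, k₀) f.support, p.1 ≤ (N : ℤ) := by
    refine ⟨(insert (i₀, j₀, k₀) f.support).sup fun p => p.1.toNat, fun p hp => ?_⟩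
    have := Finset.le_sup (f := fun p : ℤ × ℕ × ℕ => p.1.toNat) hp
    omega
  have key (n : ℕ) (hn : N ≤ n) : Q.eval (qC q ^ n) = 0 := by
    have hle (p) (hp : p ∈ insert (i₀, j₀, k₀) f.support) : p.1 ≤ (n : ℤ) :=
      (hN p hp).trans (by exact_mod_cast hn)
    obtain ⟨W, hW, H⟩ := rep_mon_e q i₀ n (hle _ (Finset.mem_insert_self _ _))
    have h1 := DFunLike.congr_fun (LinearMap.congr_fun h (e n 0))
      (((n : ℤ) - i₀).toNat, (j₀ : ℤ) - k₀)
    rw [Finsupp.linearCombination_apply, Finsupp.sum, map_sum, LinearMap.sum_apply,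
      Finsupp.finsetSum_apply] at h1
    refine (mul_eq_zero.1 (?_ : W * _ = 0)).resolve_left hW
    rw [Polynomial.eval_finsetSum, Finset.mul_sum, Finset.sum_filter]
    refine (Finset.sum_congr rfl fun p hp => ?_).trans h1
    obtain ⟨i, j, k⟩ := p
    obtain ⟨W', hW', H'⟩ := rep_mon_e q i n (hle _ (Finset.mem_insert_of_mem hp))
    have hi := hle _ (Finset.mem_insert_of_mem hp)
    have hi₀ := hle _ (Finset.mem_insert_self _ _)
    simp only at hi hi₀
    split_ifs with hc
    · obtain ⟨rfl, hc⟩ := hc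
      simp only at hc
      rw [map_smul, LinearMap.smul_apply, H, hc]
      simp [e]
      ring
    · rw [map_smul, LinearMap.smul_apply, H', e, Finsupp.smul_apply, Finsupp.smul_apply,
        Finsupp.single_eq_of_ne, smul_zero, smul_zero]
      intro hc'
      refine hc ⟨?_, (Prod.mk.inj hc').2.symm⟩
      have := (Prod.mk.inj hc').1
      simp only
      omega
  -- The powers `q^(N+n)` are infinitely many distinct roots of `Q`.
  have hQ : Q = 0 := by
    refine Polynomial.eq_zero_of_infinite_isRoot Q
      ((Set.infinite_range_of_injective (f := fun n : ℕ => qC q ^ (N + n)) ?_).mono ?_)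
    · intro m n hmn
      have h2 := congrArg norm hmn
      simp only [norm_pow, norm_qC] at h2
      have := (pow_right_strictAnti₀ q.2.1 q.2.2).injective h2
      omega
    · rintro _ ⟨n, rfl⟩
      exact key _ (by omega)
  -- Within `T` the difference `j - k` is fixed, so the degree `j + k` determines the monomial and
  -- no two terms of `Q` merge.
  have h3 : Q.coeff (j₀ + k₀) = f (i₀, j₀, k₀) := by
    rw [Polynomial.finsetSum_coeff]
    simp only [Polynomial.coeff_monomial]
    rw [Finset.sum_eq_single (i₀, j₀, k₀)]
    · simp
    · rintro ⟨i, j, k⟩ hp hne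
      refine if_neg fun hs => hne ?_
      have := (Finset.mem_filter.1 hp).2
      simp only at this hs
      ext <;> simp <;> omega
    · intro hp
      simp only [T, Finset.mem_filter, Finsupp.mem_support_iff] at hp
      simpa using hp
  rw [← h3, hQ]; rfl

theorem rep_injective (q : DefParam) : Function.Injective (rep q) := by
  refine (injective_iff_map_eq_zero _).2 fun x hx => ?_
  have hm := mem_span_mon q x
  rw [← Finsupp.range_linearCombination] at hm
  obtain ⟨f, rfl⟩ := hm
  rw [eq_zero_of_rep_sum_mon q f hx, map_zero]

theorem eq_of_coeff_eq {q : DefParam} {x y : SUq q}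
    (h : ∀ m l n k, coeff q m l n k x = coeff q m l n k y) : x = y :=
  rep_injective q (end_ext fun n k => Finsupp.ext fun p => h p.1 p.2 n k)

/-! ### Positivity and faithfulness of the Haar state -/

/-- The standard inner product of finitely supported vectors, linear in the second variable. -/
noncomputable def ip (v : V) : V →ₗ[ℂ] ℂ :=
  Finsupp.linearCombination ℂ fun p => starRingEnd ℂ (v p)

theorem e_apply (n m : ℕ) (k l : ℤ) : e n k (m, l) = if n = m ∧ k = l then 1 else 0 := by
  simp only [e, Finsupp.single_apply, Prod.mk.injEq]

theorem ip_e (v : V) (n : ℕ) (k : ℤ) : ip v (e n k) = starRingEnd ℂ (v (n, k)) := by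
  simp [ip, e]

theorem ip_add_left (v w u : V) : ip (v + w) u = ip v u + ip w u := by
  simp [ip, Finsupp.linearCombination_apply, Finsupp.sum, mul_add, Finset.sum_add_distrib]

theorem ip_smul_left (z : ℂ) (v u : V) : ip (z • v) u = starRingEnd ℂ z * ip v u := by
  simp [ip, Finsupp.linearCombination_apply, Finsupp.sum, Finset.mul_sum, mul_left_comm]

theorem ip_e_left (w : V) (n : ℕ) (k : ℤ) : ip (e n k) w = w (n, k) := by
  have h : ip (e n k) = Finsupp.lapply (n, k) := by
    refine Finsupp.lhom_ext' fun p => LinearMap.ext_ring ?_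
    simp only [ip, e, Finsupp.single_apply, LinearMap.comp_apply, Finsupp.lsingle_apply,
      Finsupp.linearCombination_single, Finsupp.lapply_apply, eq_comm (a := p)]
    split_ifs <;> simp
  rw [h, Finsupp.lapply_apply]

theorem ip_self (v : V) : ip v v = ((v.sum fun _ z => ‖z‖ ^ 2 : ℝ) : ℂ) := by
  simp only [ip, Finsupp.linearCombination_apply, Finsupp.sum, smul_eq_mul, Complex.mul_conj,
    Complex.normSq_eq_norm_sq, Complex.ofReal_sum]

theorem ip_eq_of_basis {S T : Module.End ℂ V}
    (h : ∀ n k m l, starRingEnd ℂ (S (e n k) (m, l)) = T (e m l) (n, k)) (v w : V) :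
    ip (S v) w = ip v (T w) := by
  induction w using Finsupp.induction_linear with
  | zero => simp
  | add w₁ w₂ h₁ h₂ => simp only [map_add, h₁, h₂]
  | single p z =>
    have hp : Finsupp.single p z = z • e p.1 p.2 := by simp [e]
    rw [hp, map_smul, map_smul, map_smul]
    refine congrArg (z • ·) ?_
    induction v using Finsupp.induction_linear with
    | zero => simp [ip, Finsupp.linearCombination_apply]
    | add v₁ v₂ h₁ h₂ => simp only [map_add, ip_add_left, h₁, h₂]
    | single r y =>
      have hr : Finsupp.single r y = y • e r.1 r.2 := by simp [e]
      rw [hr, map_smul, ip_smul_left, ip_smul_left, ip_e, ip_e_left, h]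

/-- The generators act by weighted shifts with real weights, those of `a*` and `c*` being the
transposes of those of `a` and `c`. Both the adjoint and the involution reverse products. -/
theorem ip_rep (q : DefParam) (x : SUq q) (v w : V) :
    ip (rep q x v) w = ip v (rep q (star x) w) := by
  induction x using SUq.induction generalizing v w with
  | hs z =>
    simp only [Algebra.algebraMap_eq_smul_one, star_smul, star_one, map_smul, map_one,
      LinearMap.smul_apply, Module.End.one_apply, ip_smul_left]
    simp
  | hg g =>
    refine ip_eq_of_basis (fun n k m l => ?_) v w
    have hw (n : ℕ) : starRingEnd ℂ (wt q n) = wt q n := Complex.conj_ofReal _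
    have hq : starRingEnd ℂ (qC q) = qC q := Complex.conj_ofReal _
    cases g
    · simp only [rep, star_a, lift_a, lift_aStar, opA_e, opAStar_e, Finsupp.smul_apply, e_apply,
        smul_eq_mul, map_mul, hw]
      -- For `n = 0` the truncated index `n - 1` is `0`, but the weight `wt q 0 = 0` annihilates the
      -- term.
      rcases n with _ | n
      · simp [wt_zero]
      · by_cases h : n = m ∧ k = l
        · obtain ⟨rfl, rfl⟩ := h; simp
        · have h' : ¬ (n + 1 - 1 = m ∧ k = l) := h
          have h'' : ¬ (m + 1 = n + 1 ∧ l = k) := by omega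
          rw [if_neg h', if_neg h'', map_zero, mul_zero, mul_zero]
    · simp only [rep, star_aStar, lift_a, lift_aStar, opA_e, opAStar_e, Finsupp.smul_apply, e_apply,
        smul_eq_mul, map_mul, hw]
      rcases m with _ | m
      · simp [wt_zero]
      · by_cases h : n = m ∧ k = l
        · obtain ⟨rfl, rfl⟩ := h; simp
        · have h' : ¬ (m + 1 - 1 = n ∧ l = k) := by omega
          have h'' : ¬ (n + 1 = m + 1 ∧ k = l) := by omega
          rw [if_neg h', if_neg h'', map_zero, mul_zero, mul_zero]
    · simp only [rep, star_c, lift_c, lift_cStar, opC_e, opCStar_e, Finsupp.smul_apply, e_apply,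
        smul_eq_mul, map_mul, map_pow, hq]
      by_cases h : n = m ∧ k + 1 = l
      · obtain ⟨rfl, rfl⟩ := h; simp
      · have h' : ¬ (m = n ∧ l - 1 = k) := by omega
        simp [h, h']
    · simp only [rep, star_cStar, lift_c, lift_cStar, opC_e, opCStar_e, Finsupp.smul_apply, e_apply,
        smul_eq_mul, map_mul, map_pow, hq]
      by_cases h : n = m ∧ k - 1 = l
      · obtain ⟨rfl, rfl⟩ := h; simp
      · have h' : ¬ (m = n ∧ l + 1 = k) := by omega
        simp [h, h']
  | hm x y hx hy => rw [star_mul, map_mul, map_mul, Module.End.mul_apply, Module.End.mul_apply,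
      hx, hy]
  | ha x y hx hy => simp only [star_add, map_add, LinearMap.add_apply, ip_add_left, hx, hy]

theorem coeff_star_mul_self (q : DefParam) (x : SUq q) (n : ℕ) (k : ℤ) :
    coeff q n k n k (star x * x) = (((rep q x (e n k)).sum fun _ z => ‖z‖ ^ 2 : ℝ) : ℂ) := by
  rw [← ip_self, ip_rep, ip_e_left, ← Module.End.mul_apply, ← map_mul]; rfl

/-- By `coeff_star_mul_self`, the Haar series of `x* x` has terms `q^(2n) ‖x e_{n,0}‖²`. If it
vanishes then so does every term, and injectivity of the representation gives `x = 0`. -/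
theorem exists_haar_star_mul_self (q : DefParam) (x : SUq q) :
    ∃ r : ℝ, 0 ≤ r ∧ haar q (star x * x) = r ∧ (r = 0 → x = 0) := by
  let N (n : ℕ) : ℝ := (rep q x (e n 0)).sum fun _ z => ‖z‖ ^ 2
  have hN (n : ℕ) : 0 ≤ N n := Finset.sum_nonneg fun _ _ => sq_nonneg _
  have hq2 : 0 < 1 - (q : ℝ) ^ 2 := sub_pos.2 (pow_lt_one₀ q.2.1.le q.2.2 two_ne_zero)
  have hc (n : ℕ) : qC q ^ (2 * n) * coeff q n 0 n 0 (star x * x) =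
      (((q : ℝ) ^ (2 * n) * N n : ℝ) : ℂ) := by
    rw [coeff_star_mul_self]; simp [qC, N]
  have hs : Summable fun n => (q : ℝ) ^ (2 * n) * N n := by
    have h := summable_haar q (star x * x)
    simp only [hc] at h
    exact Complex.summable_ofReal.1 h
  have ht (n : ℕ) : 0 ≤ (q : ℝ) ^ (2 * n) * N n := mul_nonneg (pow_nonneg q.2.1.le _) (hN n)
  refine ⟨(1 - (q : ℝ) ^ 2) * ∑' n, (q : ℝ) ^ (2 * n) * N n, mul_nonneg hq2.le (tsum_nonneg ht),
    ?_, fun h => ?_⟩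
  · change (1 - qC q ^ 2) * ∑' n : ℕ, qC q ^ (2 * n) * coeff q n 0 n 0 (star x * x) = _
    rw [tsum_congr hc]
    simp only [Complex.ofReal_mul, Complex.ofReal_tsum, Complex.ofReal_sub, Complex.ofReal_pow,
      Complex.ofReal_one, qC]
  · have h1 : HasSum (fun n => (q : ℝ) ^ (2 * n) * N n) 0 := by
      have h2 := hs.hasSum
      rwa [(mul_eq_zero.1 h).resolve_left hq2.ne'] at h2
    have h2 := (hasSum_zero_iff_of_nonneg ht).1 h1
    have h3 (n : ℕ) : rep q x (e n 0) = 0 := by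
      have h4 : N n = 0 :=
        (mul_eq_zero.1 (congrFun h2 n)).resolve_left (pow_ne_zero _ q.2.1.ne')
      ext p
      by_contra hp
      have := (Finset.sum_eq_zero_iff_of_nonneg fun _ _ => sq_nonneg _).1 h4 p
        (Finsupp.mem_support_iff.2 hp)
      exact hp (by simpa using this)
    refine eq_of_coeff_eq fun m l n k => ?_
    have h5 (l : ℤ) : coeff q m l n 0 x = 0 := by
      change rep q x (e n 0) (m, l) = 0
      rw [h3]; rfl
    rw [map_zero]
    -- The Haar series sees only the vectors `e_{n,0}`; commutation with the shift in the second
    -- index carries their vanishing to all `e_{n,k}`.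
    have h6 (j : ℤ) : ∀ l, coeff q m (l + j) n j x = coeff q m l n 0 x := by
      induction j using Int.induction_on with
      | zero => simp
      | succ i hi => intro l; rw [← add_assoc, coeff_shift, hi]
      | pred i hi =>
        intro l
        rw [← hi l, ← coeff_shift]
        congr 2 <;> ring
    rw [← sub_add_cancel l k, h6, h5]

/-! ### Derivations on the quantum projective line -/

/-- A matrix coefficient of weight `w = n - m + l - k` is multiplied by `t^w`. Invariance under the
circle kills all coefficients with `w ≠ 0`, and the others are fixed by every `t`, in particular by
the real scalars defining `K` and `K⁻¹`. -/
theorem scale_eq_self {q : DefParam} {x : SUq q} (hx : x ∈ CP q) (t : ℂˣ) :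
    scale q t x = x := by
  refine eq_of_coeff_eq fun m l n k => ?_
  rw [coeff_scale]
  rcases eq_or_ne ((n : ℤ) - m + l - k) 0 with h | h
  · rw [h, zpow_zero, one_mul]
  -- The point `z = exp(iπ/w)` has `z^w = -1`, so the coefficient equals its own negative.
  · have h1 := congrArg (coeff q m l n k) (hx (Circle.exp (Real.pi / ((n : ℤ) - m + l - k : ℤ))))
    rw [α, coeff_scale] at h1
    have h2 : ((Circle.toUnits (Circle.exp (Real.pi / ((n : ℤ) - m + l - k : ℤ))) : ℂˣ) : ℂ) ^
        ((n : ℤ) - m + l - k) = -1 := by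
      change (Circle.exp _ : ℂ) ^ _ = _
      rw [Circle.coe_exp, ← Complex.exp_int_mul, ← Complex.exp_pi_mul_I]
      congr 1
      have : ((((n : ℤ) - m + l - k : ℤ) : ℂ)) ≠ 0 := Int.cast_ne_zero.2 h
      rw [Complex.ofReal_div, Complex.ofReal_intCast]
      field_simp
    rw [h2] at h1
    have h3 : coeff q m l n k x = 0 := by linear_combination (-1 / 2 : ℂ) * h1
    rw [h3, mul_zero]

theorem Xplus_apply {q : DefParam} {x : SUq q} (hx : x ∈ CP q) :
    Xplus q x = qHalf q • E q x := by
  simp [Xplus, K, scale_eq_self hx]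

theorem Xminus_apply {q : DefParam} {x : SUq q} (hx : x ∈ CP q) :
    Xminus q x = (qHalf q)⁻¹ • F q x := by
  simp [Xminus, K, scale_eq_self hx]

theorem Xplus_mul {q : DefParam} {x y : SUq q} (hx : x ∈ CP q) (hy : y ∈ CP q) :
    Xplus q (x * y) = x * Xplus q y + Xplus q x * y := by
  rw [Xplus_apply (mul_mem hx hy), Xplus_apply hx, Xplus_apply hy, E_mul, Kinv, K,
    scale_eq_self hx, scale_eq_self hy, smul_add, mul_smul_comm, smul_mul_assoc]

theorem star_scale (q : DefParam) {t : ℂˣ} (ht : starRingEnd ℂ (t : ℂ) = t) (x : SUq q) :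
    star (scale q t x) = scale q t⁻¹ (star x) := by
  have ht' : star (t : ℂ) = t := ht
  induction x using SUq.induction with
  | hs w => simp only [Algebra.algebraMap_eq_smul_one, map_smul, map_one, star_smul, star_one]
  | hg g => cases g <;> simp [scale, ht']
  | hm x y hx hy => simp only [map_mul, star_mul, hx, hy]
  | ha x y hx hy => simp only [map_add, star_add, hx, hy]

/-- The involution reverses products and swaps `K` with `K⁻¹`, so it turns the twisted Leibniz rule
of `E` into that of `F`. Comparison on generators then suffices. -/
theorem star_E (q : DefParam) (x : SUq q) : star (E q x) = -(qC q • F q (star x)) := by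
  have hq : starRingEnd ℂ (qC q) = qC q := Complex.conj_ofReal _
  have hh : starRingEnd ℂ (qHalf q) = qHalf q := Complex.conj_ofReal _
  have h0 := qC_ne_zero q
  have e := E_gen q
  have f := F_gen q
  induction x using SUq.induction with
  | hs w =>
    rw [E_algebraMap, Algebra.algebraMap_eq_smul_one, star_smul, star_one,
      ← Algebra.algebraMap_eq_smul_one, F_algebraMap, star_zero, smul_zero, neg_zero]
  | hg g => cases g <;> simp [e, f, hq, smul_smul, h0]
  | hm x y hx hy =>
    have h1 : star (K q y) = Kinv q (star y) := by
      rw [K, star_scale q (by simp [hh]), inv_inv]; rfl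
    have h2 : star (Kinv q x) = K q (star x) := by
      rw [Kinv, star_scale q (by simp [hh])]; rfl
    rw [E_mul, star_add, star_mul, star_mul, star_mul, F_mul, hx, hy, h1, h2]
    simp only [smul_add, neg_mul, mul_neg, smul_mul_assoc, mul_smul_comm, neg_add]
    rw [add_comm]
  | ha x y hx hy => simp only [map_add, star_add, hx, hy, smul_add, neg_add]

/-- One factor `q` comes from `star_E`, the other from the ratio of the normalizations `q^(1/2)` and
`q^(-1/2)`. -/
theorem Xplus_star {q : DefParam} {x : SUq q} (hx : x ∈ CP q) :
    star (Xplus q x) = -(qC q ^ 2 • Xminus q (star x)) := by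
  have hh : star (qHalf q) = qHalf q := Complex.conj_ofReal _
  have h0 := qHalf_ne_zero q
  rw [Xplus_apply hx, Xminus_apply (star_mem hx), star_smul, star_E, hh, smul_neg, smul_smul,
    smul_smul, ← qHalf_mul_self]
  congr 2
  field_simp

open Matrix

/-! ### Matrices over the coordinate algebra of quantum `SU(2)` -/

section
variable {q : DefParam} {n : ℕ}

/-- The matrix of the coefficients of `ω₋`. -/
def coeffMinus (η : Mat n (Omega1 q)) : Mat n (SUq q) := η.map fun x => x.1

/-- The matrix of the coefficients of `ω₊`. -/
def coeffPlus (η : Mat n (Omega1 q)) : Mat n (SUq q) := η.map fun x => x.2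

/-- A matrix over `A(CP¹_q)`, with entries regarded in `A(SU_q(2))`. -/
def toSUq (M : Mat n (CP q)) : Mat n (SUq q) := M.map fun x => x

theorem form_eq_iff {η θ : Mat n (Omega1 q)} :
    η = θ ↔ coeffMinus η = coeffMinus θ ∧ coeffPlus η = coeffPlus θ := by
  refine ⟨fun h => h ▸ ⟨rfl, rfl⟩, fun ⟨h₁, h₂⟩ => ?_⟩
  ext i j
  · exact congrFun (congrFun h₁ i) j
  · exact congrFun (congrFun h₂ i) j

theorem coeffMinus_mulForm (M : Mat n (CP q)) (η : Mat n (Omega1 q)) :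
    coeffMinus (mulForm M η) = toSUq M * coeffMinus η := by
  ext i j
  simp only [coeffMinus, mulForm, toSUq, map_apply, of_apply, mul_apply, Prod.fst_sum,
    AddSubmonoidClass.coe_finsetSum]
  rfl

theorem coeffPlus_mulForm (M : Mat n (CP q)) (η : Mat n (Omega1 q)) :
    coeffPlus (mulForm M η) = toSUq M * coeffPlus η := by
  ext i j
  simp only [coeffPlus, mulForm, toSUq, map_apply, of_apply, mul_apply, Prod.snd_sum,
    AddSubmonoidClass.coe_finsetSum]
  rfl

theorem coeffMinus_hodge (η : Mat n (Omega1 q)) : coeffMinus (η.map hodge) = -coeffMinus η := rfl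

theorem coeffPlus_hodge (η : Mat n (Omega1 q)) : coeffPlus (η.map hodge) = coeffPlus η := rfl

theorem coeffMinus_neg (η : Mat n (Omega1 q)) : coeffMinus (-η) = -coeffMinus η := rfl

theorem coeffPlus_neg (η : Mat n (Omega1 q)) : coeffPlus (-η) = -coeffPlus η := rfl

theorem coeffMinus_zero : coeffMinus (0 : Mat n (Omega1 q)) = 0 := rfl

theorem coeffPlus_zero : coeffPlus (0 : Mat n (Omega1 q)) = 0 := rfl

theorem coeffMinus_del (P : Mat n (CP q)) : coeffMinus (P.map del) = 0 := rfl

theorem coeffPlus_delbar (P : Mat n (CP q)) : coeffPlus (P.map delbar) = 0 := rfl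

theorem coeffMinus_d (P : Mat n (CP q)) : coeffMinus (P.map d) = coeffMinus (P.map delbar) := by
  ext i j
  simp [coeffMinus, d, del]

theorem coeffPlus_d (P : Mat n (CP q)) : coeffPlus (P.map d) = coeffPlus (P.map del) := by
  ext i j
  simp [coeffPlus, d, delbar]

theorem toSUq_wedgeForm (η θ : Mat n (Omega1 q)) :
    toSUq (wedgeForm η θ) =
      qC q ^ 2 • (coeffMinus η * coeffPlus θ) - coeffPlus η * coeffMinus θ := by
  ext i j
  simp only [toSUq, wedgeForm, wedge, coeffMinus, coeffPlus, map_apply, of_apply, mul_apply,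
    AddSubmonoidClass.coe_finsetSum, Matrix.sub_apply, Matrix.smul_apply, Finset.smul_sum,
    ← Finset.sum_sub_distrib]
  rfl

/-- The `j`-th diagonal entry `q^(n-2j)` of `π_{n/2}(K²)`. -/
noncomputable def traceWeight (q : DefParam) (n : ℕ) (j : Fin (n + 1)) : ℝ :=
  ((q : ℝ) ^ ((n : ℝ) / 2 - ((j : ℕ) : ℝ))) ^ 2

theorem traceWeight_pos (q : DefParam) (n : ℕ) (j : Fin (n + 1)) : 0 < traceWeight q n j :=
  pow_pos (Real.rpow_pos_of_pos q.2.1 _) 2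

/-- The composition of the Haar state with the quantum trace. -/
noncomputable def haarTrace (M : Mat n (SUq q)) : ℂ :=
  ∑ j, (traceWeight q n j : ℂ) * haar q (M j j)

theorem integral_qtr (M : Mat n (CP q)) : integral (qtr M) = haarTrace (toSUq M) := by
  have h (j : Fin (n + 1)) : ∑ l, (spinK q n ^ 2) l j • M j l =
      (traceWeight q n j : ℂ) • M j j := by
    rw [Finset.sum_eq_single j]
    · simp [spinK, diagonal_pow, traceWeight]
    · intro l _ hl
      simp [spinK, diagonal_pow, hl]
    · simp
  simp only [integral, qtr, h, haarTrace, toSUq, AddSubmonoidClass.coe_finsetSum, map_sum]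
  refine Finset.sum_congr rfl fun j _ => ?_
  exact map_smul (haar q) _ _

theorem haarTrace_add (M N : Mat n (SUq q)) :
    haarTrace (M + N) = haarTrace M + haarTrace N := by
  simp [haarTrace, mul_add, Finset.sum_add_distrib]

theorem haarTrace_sub (M N : Mat n (SUq q)) :
    haarTrace (M - N) = haarTrace M - haarTrace N := by
  simp [haarTrace, mul_sub, Finset.sum_sub_distrib]

theorem haarTrace_smul (z : ℂ) (M : Mat n (SUq q)) : haarTrace (z • M) = z * haarTrace M := by
  simp [haarTrace, Finset.mul_sum, mul_left_comm]

/-- The diagonal entries of `C* C` are sums of terms `x* x`, and the quantum trace weighs them by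
positive numbers. Faithfulness passes from the Haar state to matrices entry by entry. -/
theorem exists_haarTrace_conjTranspose_mul_self (C : Mat n (SUq q)) :
    ∃ r : ℝ, 0 ≤ r ∧ haarTrace (Cᴴ * C) = r ∧ (r = 0 ↔ C = 0) := by
  choose r hr h hz using exists_haar_star_mul_self q
  have h0 (k j) : 0 ≤ traceWeight q n j * r (C k j) :=
    mul_nonneg (traceWeight_pos q n j).le (hr _)
  have e : haarTrace (Cᴴ * C) = ((∑ j, ∑ k, traceWeight q n j * r (C k j) : ℝ) : ℂ) := by
    simp [haarTrace, mul_apply, h, Finset.mul_sum]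
  refine ⟨_, Finset.sum_nonneg fun j _ => Finset.sum_nonneg fun k _ => h0 k j, e,
    fun hs => ?_, fun hC => ?_⟩
  · ext k j
    have h1 := (Finset.sum_eq_zero_iff_of_nonneg
      fun j _ => Finset.sum_nonneg fun k _ => h0 k j).1 hs j (Finset.mem_univ _)
    have h2 := (Finset.sum_eq_zero_iff_of_nonneg fun k _ => h0 k j).1 h1 k (Finset.mem_univ _)
    exact hz _ ((mul_eq_zero.1 h2).resolve_left (traceWeight_pos q n j).ne')
  · rw [← Complex.ofReal_inj, ← e, hC]
    simp [haarTrace]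

end

/-! ### Projections -/

section
variable {q : DefParam} {n : ℕ} {P : Mat n (CP q)}

theorem toSUq_mul_self (hP : IsStarProjection P) : toSUq P * toSUq P = toSUq P := by
  conv_rhs => rw [← hP.isIdempotentElem.eq]
  ext i j
  simp [toSUq, mul_apply]

theorem conjTranspose_toSUq (hP : IsStarProjection P) : (toSUq P)ᴴ = toSUq P := by
  ext i j
  exact congrArg Subtype.val (congrFun (congrFun hP.isSelfAdjoint.star_eq i) j)

theorem coeffPlus_del_eq (hP : IsStarProjection P) : coeffPlus (P.map del) =
    toSUq P * coeffPlus (P.map del) + coeffPlus (P.map del) * toSUq P := by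
  ext i j
  have h := congrArg (fun x : CP q => Xplus q x)
    (congrFun (congrFun hP.isIdempotentElem.eq i) j)
  simp only [mul_apply, AddSubmonoidClass.coe_finsetSum, MulMemClass.coe_mul, map_sum,
    Xplus_mul (P _ _).2 (P _ _).2, Finset.sum_add_distrib] at h
  rw [Matrix.add_apply, mul_apply, mul_apply]
  exact h.symm

theorem conjTranspose_coeffPlus_del (hP : IsStarProjection P) :
    (coeffPlus (P.map del))ᴴ = -(qC q ^ 2 • coeffMinus (P.map delbar)) := by
  ext i j
  have h : star (P j i : SUq q) = P i j :=
    congrArg Subtype.val (congrFun (congrFun hP.isSelfAdjoint.star_eq i) j)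
  refine (Xplus_star (P j i).2).trans ?_
  rw [h]; rfl

/-- Multiplying `a = pa + ap` by `p` on the left gives `pa = pa + pap`. -/
theorem mul_mul_eq_zero_of_eq {R : Type} [Ring R] {p a : R} (hp : p * p = p)
    (h : a = p * a + a * p) : p * a * p = 0 := by
  have h1 : p * a = p * a + p * a * p := by
    nth_rewrite 1 [h]
    rw [mul_add, ← mul_assoc, ← mul_assoc, hp]
  simpa using h1

/-- For a derivation `a = pa + ap` and a second one `b`, `p a b = (p a) (b p)`. -/
theorem mul_mul_eq_mul_mul_mul {R : Type} [Ring R] {p a b : R} (hp : p * p = p)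
    (ha : a = p * a + a * p) (hb : b = p * b + b * p) : p * a * b = p * a * (b * p) := by
  nth_rewrite 1 [hb]
  rw [mul_add, ← mul_assoc, mul_mul_eq_zero_of_eq hp ha, zero_mul, zero_add]

/-- Here `u` is the energy of the `ω₋` part and `v` that of the `ω₊` part. The Hodge operator
changes the sign of the first only, hence `v + u` against `v - u`. -/
theorem exists_energies (hP : IsStarProjection P) : ∃ u v : ℝ, 0 ≤ u ∧ 0 ≤ v ∧
    integral (qtr (wedgeForm (mulForm P ((P.map d).map hodge)) (P.map d))) = ((v + u : ℝ) : ℂ) ∧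
    integral (qtr (wedgeForm (mulForm P (P.map d)) (P.map d))) = ((v - u : ℝ) : ℂ) ∧
    (u = 0 ↔ mulForm P (P.map delbar) = 0) ∧ (v = 0 ↔ mulForm P (P.map del) = 0) := by
  have hq := pow_ne_zero 2 (qC_ne_zero q)
  have hqr : (0 : ℝ) < ((q : ℝ) ^ 2)⁻¹ := inv_pos.2 (pow_pos q.2.1 2)
  have hQ := toSUq_mul_self hP
  have hs := conjTranspose_toSUq hP
  have hA := coeffPlus_del_eq hP
  have hAB := conjTranspose_coeffPlus_del hP
  simp only [integral_qtr, toSUq_wedgeForm, coeffMinus_mulForm, coeffPlus_mulForm,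
    coeffMinus_hodge, coeffPlus_hodge, coeffMinus_d, coeffPlus_d, form_eq_iff, coeffMinus_zero,
    coeffPlus_zero, coeffMinus_del, coeffPlus_delbar, mul_zero, true_and, and_true]
  set Q := toSUq P
  set A := coeffPlus (P.map del)
  set B := coeffMinus (P.map delbar)
  -- The identity `A = QA + AQ` is stable under adjoints, its two summands being exchanged, so
  -- `mul_mul_eq_mul_mul_mul` applies to `A` and `Aᴴ` in either order.
  have hA' : Aᴴ = Q * Aᴴ + Aᴴ * Q := by
    conv_lhs => rw [hA, conjTranspose_add, conjTranspose_mul, conjTranspose_mul, hs, add_comm]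
  have h1 : (A * Q)ᴴ * (A * Q) = Q * Aᴴ * A := by
    rw [conjTranspose_mul, hs, mul_mul_eq_mul_mul_mul hQ hA' hA]
  have h2 : (Q * A)ᴴᴴ * (Q * A)ᴴ = Q * A * Aᴴ := by
    rw [conjTranspose_conjTranspose, conjTranspose_mul, hs, mul_mul_eq_mul_mul_mul hQ hA hA']
  have hB : B = -((qC q ^ 2)⁻¹ • Aᴴ) := by
    rw [hAB, smul_neg, neg_neg, smul_smul, inv_mul_cancel₀ hq, one_smul]
  obtain ⟨u, hu, hu1, hu0⟩ := exists_haarTrace_conjTranspose_mul_self (A * Q)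
  obtain ⟨v, hv, hv1, hv0⟩ := exists_haarTrace_conjTranspose_mul_self (Q * A)ᴴ
  rw [h1] at hu1
  rw [h2] at hv1
  have hr : (qC q ^ 2)⁻¹ = ((((q : ℝ) ^ 2)⁻¹ : ℝ) : ℂ) := by simp [qC]
  -- The factor `q⁻²` in `B = -q⁻² Aᴴ` survives in `Q A B`, but cancels against the `q²` of the
  -- wedge product in `Q B A`.
  refine ⟨u, ((q : ℝ) ^ 2)⁻¹ * v, hu, mul_nonneg hqr.le hv, ?_, ?_, ?_, ?_⟩
  · rw [hB]
    simp only [neg_neg, mul_neg, mul_smul_comm, smul_mul_assoc, smul_smul, sub_neg_eq_add,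
      haarTrace_add, haarTrace_smul, hu1, hv1]
    rw [Complex.ofReal_add, Complex.ofReal_mul, ← hr]
    linear_combination (u : ℂ) * mul_inv_cancel₀ hq
  · rw [hB]
    simp only [mul_neg, neg_mul, mul_smul_comm, smul_mul_assoc, smul_neg, smul_smul,
      sub_neg_eq_add, ← sub_eq_neg_add, haarTrace_sub, haarTrace_smul, hu1, hv1]
    rw [Complex.ofReal_sub, Complex.ofReal_mul, ← hr]
    linear_combination (-u : ℂ) * mul_inv_cancel₀ hq
  -- `AQ` vanishes together with its adjoint `Q Aᴴ = -q² Q B`.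
  · rw [hu0, ← conjTranspose_eq_zero, conjTranspose_mul, hs, hAB, mul_neg, neg_eq_zero,
      mul_smul_comm, smul_eq_zero_iff_right hq]
  · rw [mul_eq_zero_iff_left hqr.ne', hv0, conjTranspose_eq_zero]

/-! ### The self-duality equations -/

theorem eq_neg_self_iff_eq_zero {M : Mat n (SUq q)} : M = -M ↔ M = 0 := by
  refine ⟨fun h => ?_, fun h => by rw [h, neg_zero]⟩
  have h2 : (2 : ℂ) • M = 0 := by rw [two_smul]; nth_rewrite 1 [h]; exact neg_add_cancel M
  exact (smul_eq_zero_iff_right two_ne_zero).1 h2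

/-- The `ω₋` component of the equation holds automatically, and the `ω₊` component says that the
coefficient of `P ∂P` equals its negative. -/
theorem hodge_eq_neg_iff (P : Mat n (CP q)) :
    (mulForm P (P.map d)).map hodge = -mulForm P (P.map d) ↔ mulForm P (P.map del) = 0 := by
  simp only [coeffMinus_mulForm, coeffPlus_mulForm, coeffMinus_hodge, coeffPlus_hodge,
    coeffMinus_d, coeffPlus_d, form_eq_iff, coeffMinus_zero, coeffPlus_zero, coeffMinus_del,
    coeffMinus_neg, coeffPlus_neg, mul_zero, true_and, eq_neg_self_iff_eq_zero]

theorem hodge_eq_iff (P : Mat n (CP q)) :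
    (mulForm P (P.map d)).map hodge = mulForm P (P.map d) ↔ mulForm P (P.map delbar) = 0 := by
  simp only [coeffMinus_mulForm, coeffPlus_mulForm, coeffMinus_hodge, coeffPlus_hodge,
    coeffMinus_d, coeffPlus_d, form_eq_iff, coeffMinus_zero, coeffPlus_zero, coeffPlus_delbar,
    mul_zero, and_true, neg_eq_iff_eq_neg, eq_neg_self_iff_eq_zero]

end

end QuantumProjectiveLine

open QuantumProjectiveLine in
theorem proposition4p2 (q : DefParam) (n : ℕ) (P : Mat n (CP q)) (hP : IsStarProjection P) :
    ((integral (qtr (wedgeForm (mulForm P ((P.map d).map hodge)) (P.map d)))).im = 0 ∧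
      ‖integral (qtr (wedgeForm (mulForm P (P.map d)) (P.map d)))‖ ≤
        (integral (qtr (wedgeForm (mulForm P ((P.map d).map hodge)) (P.map d)))).re) ∧
    (integral (qtr (wedgeForm (mulForm P ((P.map d).map hodge)) (P.map d))) =
        (‖integral (qtr (wedgeForm (mulForm P (P.map d)) (P.map d)))‖ : ℂ) ↔
      (mulForm P (P.map d)).map hodge = mulForm P (P.map d) ∨
        (mulForm P (P.map d)).map hodge = -mulForm P (P.map d)) ∧
    ((mulForm P (P.map d)).map hodge = -mulForm P (P.map d) ↔ mulForm P (P.map del) = 0) ∧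
    ((mulForm P (P.map d)).map hodge = mulForm P (P.map d) ↔ mulForm P (P.map delbar) = 0) ∧
    (mulForm P (P.map delbar) = 0 → IsInstanton P) ∧
    (mulForm P (P.map del) = 0 → IsAntiInstanton P) := by
  obtain ⟨u, v, hu, hv, h1, h2, hu0, hv0⟩ := exists_energies hP
  refine ⟨?_, ?_, hodge_eq_neg_iff P, hodge_eq_iff P, fun h => ⟨hP, (hodge_eq_iff P).2 h⟩,
    fun h => ⟨hP, (hodge_eq_neg_iff P).2 h⟩⟩
  · rw [h1, h2, Complex.ofReal_im, Complex.ofReal_re, Complex.norm_real, Real.norm_eq_abs]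
    exact ⟨rfl, abs_le.2 ⟨by linarith, by linarith⟩⟩
  · rw [hodge_eq_iff, hodge_eq_neg_iff, ← hu0, ← hv0, h1, h2, Complex.norm_real, Real.norm_eq_abs,
      Complex.ofReal_inj]
    constructor
    · intro h
      -- `v + u = v - u` forces `u = 0`, the instanton case; `v + u = u - v` forces `v = 0`, the
      -- anti-instanton case.
      rcases abs_choice (v - u) with h' | h'
      · left; linarith
      · right; linarith
    · rintro (rfl | rfl)
      · rw [add_zero, sub_zero, abs_of_nonneg hv]
      · rw [zero_add, zero_sub, abs_neg, abs_of_nonneg hu]
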